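/- Let $A\ge 1$, $B>0$, $D>0$ and let $Q\subset\mathbb R^2$ be compact. There is a constant $C=C(A,B,D,Q)>0$ with the following property. Let $0<\delta\le D$, $I=[\delta,2\delta]$, and let $K\subseteq Q\times I$ be compact. Let $\alpha,\beta:\mathbb R^2\to\mathbb R$ be (Lebesgue) measurable functions such that either (i) $A^{-1}\le|\alpha(z)|\le A$ and $|\beta(z)|\le A$ for all $z\in\mathbb R^2$, or (ii) $|\alpha(z)|\le A$ and $A^{-1}\le|\beta(z)|\le A$ for all $z\in\mathbb R^2$. Then for all $\epsilon\in(0,1]$ the three-dimensional Lebesgue measure satisfies \[ \bigl|\{(x,y,t)\in K:\ |\alpha(x+\cos t,y)\sin t+\beta(x,y+\sin t)\cos t|\le B\,\delta\epsilon\}\bigr|\le C\,\delta\,\epsilon^{1/35}. \] -/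

import Mathlib

/-- The set of `((x, y), t) ∈ K` at which
`|α(x + cos t, y) sin t + β(x, y + sin t) cos t| ≤ r`. -/
def sublevelSet (K : Set ((ℝ × ℝ) × ℝ)) (α β : ℝ × ℝ → ℝ) (r : ℝ) : Set ((ℝ × ℝ) × ℝ) :=
  {p ∈ K | |α (p.1.1 + Real.cos p.2, p.1.2) * Real.sin p.2
      + β (p.1.1, p.1.2 + Real.sin p.2) * Real.cos p.2| ≤ r}

open MeasureTheory Set

/-- The determinant of the matrix with rows `a`, `b`, `c`. -/
def det3 (a b c : ℝ × ℝ × ℝ) : ℝ :=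
  a.1 * (b.2.1 * c.2.2 - b.2.2 * c.2.1) - a.2.1 * (b.1 * c.2.2 - b.2.2 * c.1)
    + a.2.2 * (b.1 * c.2.1 - b.2.1 * c.1)

/-- The values of `f` at three points. -/
def triple (f : ℝ → ℝ) (s : ℝ × ℝ × ℝ) : ℝ × ℝ × ℝ := (f s.1, f s.2.1, f s.2.2)

/-- The absolute value of the Vandermonde determinant. -/
def absVandermonde (s : ℝ × ℝ × ℝ) : ℝ := |s.1 - s.2.1| * |s.2.1 - s.2.2| * |s.1 - s.2.2|

theorem hasDerivAt_cotWeight {y : ℝ} (hy : 0 < y) :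
    HasDerivAt (fun y : ℝ => (1 + y ^ 2) * √(1 + y ^ 2) / y)
      (√(1 + y ^ 2) * (2 - 1 / y ^ 2)) y := by
  have h1 : HasDerivAt (fun y : ℝ => 1 + y ^ 2) (2 * y) y := by
    simpa using (hasDerivAt_pow 2 y).const_add 1
  have hpos : 0 < 1 + y ^ 2 := by positivity
  have hs : 0 < √(1 + y ^ 2) := Real.sqrt_pos.2 hpos
  have h2 := h1.sqrt hpos.ne'
  refine ((h1.mul h2).div (hasDerivAt_id y) hy.ne').congr_deriv ?_
  have hsq : √(1 + y ^ 2) ^ 2 = 1 + y ^ 2 := Real.sq_sqrt hpos.le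
  simp only [id, Pi.mul_apply]
  field_simp
  rw [hsq]
  ring

theorem hasDerivAt_deriv_cotWeight {y : ℝ} (hy : 0 < y) :
    HasDerivAt (fun y : ℝ => √(1 + y ^ 2) * (2 - 1 / y ^ 2))
      ((2 * y + 1 / y + 2 / y ^ 3) / √(1 + y ^ 2)) y := by
  have h1 : HasDerivAt (fun y : ℝ => 1 + y ^ 2) (2 * y) y := by
    simpa using (hasDerivAt_pow 2 y).const_add 1
  have hpos : 0 < 1 + y ^ 2 := by positivity
  have hs : 0 < √(1 + y ^ 2) := Real.sqrt_pos.2 hpos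
  have h2 := h1.sqrt hpos.ne'
  have h3 : HasDerivAt (fun y : ℝ => 2 - 1 / y ^ 2) (2 / y ^ 3) y := by
    have h4 : HasDerivAt (fun y : ℝ => y ^ 2) (2 * y) y := by simpa using hasDerivAt_pow 2 y
    refine (((hasDerivAt_const y (1 : ℝ)).div h4 (by positivity)).const_sub 2).congr_deriv ?_
    field_simp
    ring
  refine (h2.mul h3).congr_deriv ?_
  have hsq : √(1 + y ^ 2) ^ 2 = 1 + y ^ 2 := Real.sq_sqrt hpos.le
  field_simp
  rw [hsq]
  ring

theorem convexOn_cotWeight_sub :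
    ConvexOn ℝ (Ioi (0 : ℝ)) fun y => (1 + y ^ 2) * √(1 + y ^ 2) / y - y ^ 2 / 2 := by
  have hd : ∀ y : ℝ, 0 < y → HasDerivAt (fun y => (1 + y ^ 2) * √(1 + y ^ 2) / y - y ^ 2 / 2)
      (√(1 + y ^ 2) * (2 - 1 / y ^ 2) - y) y := fun y hy => by
    refine ((hasDerivAt_cotWeight hy).sub ((hasDerivAt_pow 2 y).div_const 2)).congr_deriv ?_
    simp
  have hd2 : ∀ y : ℝ, 0 < y → HasDerivAt (fun y => √(1 + y ^ 2) * (2 - 1 / y ^ 2) - y)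
      ((2 * y + 1 / y + 2 / y ^ 3) / √(1 + y ^ 2) - 1) y := fun y hy =>
    (hasDerivAt_deriv_cotWeight hy).sub (hasDerivAt_id y)
  refine convexOn_of_hasDerivWithinAt2_nonneg (convex_Ioi 0)
    (f' := fun y => √(1 + y ^ 2) * (2 - 1 / y ^ 2) - y)
    (f'' := fun y => (2 * y + 1 / y + 2 / y ^ 3) / √(1 + y ^ 2) - 1)
    (fun y hy => (hd y hy).continuousAt.continuousWithinAt) ?_ ?_ ?_
  · intro y hy; rw [interior_Ioi] at hy; exact (hd y hy).hasDerivWithinAt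
  · intro y hy; rw [interior_Ioi] at hy; exact (hd2 y hy).hasDerivWithinAt
  · intro y hy
    rw [interior_Ioi] at hy
    have hy : 0 < y := hy
    have hs : 0 < √(1 + y ^ 2) := Real.sqrt_pos.2 (by positivity)
    rw [sub_nonneg, le_div_iff₀ hs, one_mul]
    have h1 : √(1 + y ^ 2) ≤ 1 + y := Real.sqrt_le_iff.2 ⟨by positivity, by nlinarith⟩
    have h2 : 1 ≤ y + 1 / y := by
      have : y + 1 / y - 1 = ((y - 1) ^ 2 + y) / y := by field_simp; ring
      have h3 : 0 ≤ ((y - 1) ^ 2 + y) / y := by positivity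
      linarith
    have h3 : 0 ≤ 2 / y ^ 3 := by positivity
    linarith

theorem vandermonde_le_of_convexOn {S : Set ℝ} {f : ℝ → ℝ}
    (hf : ConvexOn ℝ S fun y => f y - y ^ 2 / 2) {y : ℝ × ℝ × ℝ}
    (h1 : y.1 ∈ S) (h2 : y.2.1 ∈ S) (h3 : y.2.2 ∈ S) :
    absVandermonde y / 2 ≤ |det3 (1, 1, 1) y (triple f y)| := by
  have key : ∀ a b c : ℝ, a ∈ S → c ∈ S → a < b → b < c →
      (b - a) * (c - b) * (c - a) / 2 ≤ (b - a) * (f c - f b) - (f b - f a) * (c - b) := by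
    intro a b c ha hc hab hbc
    have h := hf.slope_mono_adjacent ha hc hab hbc
    rw [div_le_div_iff₀ (by linarith) (by linarith)] at h
    nlinarith
  obtain ⟨a, b, c⟩ := y
  simp only [absVandermonde, det3, triple] at *
  rcases lt_trichotomy a b with hab | rfl | hab
  · rcases lt_trichotomy b c with hbc | rfl | hbc
    · have := key a b c h1 h3 hab hbc
      rw [abs_of_neg (by linarith : a - b < 0), abs_of_neg (by linarith : b - c < 0),
        abs_of_neg (by linarith : a - c < 0)]
      exact le_trans (by linarith) (le_abs_self _)
    · simp
    · rcases lt_trichotomy a c with hac | rfl | hac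
      · have := key a c b h1 h2 hac hbc
        rw [abs_of_neg (by linarith : a - b < 0), abs_of_pos (by linarith : 0 < b - c),
          abs_of_neg (by linarith : a - c < 0)]
        exact le_trans (by linarith) (neg_le_abs _)
      · simp
      · have := key c a b h3 h2 hac hab
        rw [abs_of_neg (by linarith : a - b < 0), abs_of_pos (by linarith : 0 < b - c),
          abs_of_pos (by linarith : 0 < a - c)]
        exact le_trans (by linarith) (le_abs_self _)
  · simp
  · rcases lt_trichotomy b c with hbc | rfl | hbc
    · rcases lt_trichotomy a c with hac | rfl | hac
      · have := key b a c h2 h3 hab hac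
        rw [abs_of_pos (by linarith : 0 < a - b), abs_of_neg (by linarith : b - c < 0),
          abs_of_neg (by linarith : a - c < 0)]
        exact le_trans (by linarith) (neg_le_abs _)
      · simp
      · have := key b c a h2 h1 hbc hac
        rw [abs_of_pos (by linarith : 0 < a - b), abs_of_neg (by linarith : b - c < 0),
          abs_of_pos (by linarith : 0 < a - c)]
        exact le_trans (by linarith) (le_abs_self _)
    · simp
    · have := key c b a h3 h1 hbc hab
      rw [abs_of_pos (by linarith : 0 < a - b), abs_of_pos (by linarith : 0 < b - c),
        abs_of_pos (by linarith : 0 < a - c)]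
      exact le_trans (by linarith) (neg_le_abs _)

/-- The determinant of the derivatives of `cos`, `sin` and `log ∘ tan` at three points. -/
noncomputable def trigDet (u : ℝ × ℝ × ℝ) : ℝ :=
  det3 (triple (fun t => -Real.sin t) u) (triple Real.cos u)
    (triple (fun t => 1 / (Real.sin t * Real.cos t)) u)

theorem le_abs_trigDet {τ : ℝ} {u : ℝ × ℝ × ℝ}
    (h1 : u.1 ∈ Ioo 0 (Real.pi / 2)) (h2 : u.2.1 ∈ Ioo 0 (Real.pi / 2))
    (h3 : u.2.2 ∈ Ioo 0 (Real.pi / 2)) (t1 : u.1 ≤ τ) (t2 : u.2.1 ≤ τ) (t3 : u.2.2 ≤ τ) :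
    (2 / Real.pi) ^ 3 / 2 * absVandermonde u ≤ τ ^ 3 * |trigDet u| := by
  obtain ⟨a, b, c⟩ := u
  simp only at h1 h2 h3 t1 t2 t3
  have hsin : ∀ x ∈ Ioo 0 (Real.pi / 2), 0 < Real.sin x := fun x hx =>
    Real.sin_pos_of_pos_of_lt_pi hx.1 (by linarith [hx.2, Real.pi_pos])
  have hcos : ∀ x ∈ Ioo 0 (Real.pi / 2), 0 < Real.cos x := fun x hx =>
    Real.cos_pos_of_mem_Ioo ⟨by linarith [hx.1, Real.pi_pos], hx.2⟩
  have hcot : ∀ x ∈ Ioo 0 (Real.pi / 2), 0 < Real.cos x / Real.sin x := fun x hx =>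
    div_pos (hcos x hx) (hsin x hx)
  have hk : ∀ x ∈ Ioo 0 (Real.pi / 2),
      (1 + (Real.cos x / Real.sin x) ^ 2) * √(1 + (Real.cos x / Real.sin x) ^ 2) /
        (Real.cos x / Real.sin x) = 1 / (Real.sin x ^ 2 * Real.cos x) := by
    intro x hx
    have hs := hsin x hx
    have hc := hcos x hx
    have e : 1 + (Real.cos x / Real.sin x) ^ 2 = (1 / Real.sin x) ^ 2 := by
      field_simp; exact Real.sin_sq_add_cos_sq x
    rw [e, Real.sqrt_sq (by positivity)]
    field_simp
  have hconv := vandermonde_le_of_convexOn convexOn_cotWeight_sub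
    (y := (Real.cos a / Real.sin a, Real.cos b / Real.sin b, Real.cos c / Real.sin c))
    (hcot a h1) (hcot b h2) (hcot c h3)
  have hdiff : ∀ x ∈ Ioo 0 (Real.pi / 2), ∀ y ∈ Ioo 0 (Real.pi / 2),
      2 / Real.pi * |x - y| / (Real.sin x * Real.sin y)
        ≤ |Real.cos x / Real.sin x - Real.cos y / Real.sin y| := by
    intro x hx y hy
    have hs := hsin x hx
    have hs' := hsin y hy
    have e : Real.cos x / Real.sin x - Real.cos y / Real.sin y
        = -(Real.sin (x - y) / (Real.sin x * Real.sin y)) := by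
      rw [Real.sin_sub]; field_simp; ring
    rw [e, abs_neg, abs_div, abs_of_pos (mul_pos hs hs')]
    gcongr
    exact Real.mul_abs_le_abs_sin
      (abs_le.2 ⟨by linarith [hx.1, hy.2], by linarith [hx.2, hy.1]⟩)
  have sa := hsin a h1
  have sb := hsin b h2
  have sc := hsin c h3
  have ca := hcos a h1
  have cb := hcos b h2
  have cc := hcos c h3
  have hdet : trigDet (a, b, c) = -(Real.sin a * Real.sin b * Real.sin c) *
      det3 (1, 1, 1) (Real.cos a / Real.sin a, Real.cos b / Real.sin b, Real.cos c / Real.sin c)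
      (triple (fun y => (1 + y ^ 2) * √(1 + y ^ 2) / y)
        (Real.cos a / Real.sin a, Real.cos b / Real.sin b, Real.cos c / Real.sin c)) := by
    simp only [trigDet, triple, det3, hk a h1, hk b h2, hk c h3]
    field_simp
    ring
  rw [hdet, abs_mul, abs_neg, abs_of_pos (by positivity)]
  have hv : (2 / Real.pi) ^ 3 * absVandermonde (a, b, c) /
      (Real.sin a * Real.sin b * Real.sin c) ^ 2 ≤ absVandermonde
        (Real.cos a / Real.sin a, Real.cos b / Real.sin b, Real.cos c / Real.sin c) := by
    have hpi : 0 < 2 / Real.pi := div_pos two_pos Real.pi_pos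
    have := mul_le_mul (mul_le_mul (hdiff a h1 b h2) (hdiff b h2 c h3) (by positivity)
      (by positivity)) (hdiff a h1 c h3) (by positivity) (by positivity)
    refine le_of_eq_of_le ?_ this
    simp only [absVandermonde]
    field_simp
  have hτ : Real.sin a * Real.sin b * Real.sin c ≤ τ ^ 3 := by
    have e1 := (Real.sin_lt h1.1).le.trans t1
    have e2 := (Real.sin_lt h2.1).le.trans t2
    have e3 := (Real.sin_lt h3.1).le.trans t3
    have hτ0 : 0 ≤ τ := h1.1.le.trans t1
    calc _ ≤ τ * τ * τ := by gcongr
      _ = τ ^ 3 := by ring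
  set P := Real.sin a * Real.sin b * Real.sin c with hP
  have hPpos : 0 < P := by positivity
  have hV0 : 0 ≤ absVandermonde (a, b, c) := by unfold absVandermonde; positivity
  calc (2 / Real.pi) ^ 3 / 2 * absVandermonde (a, b, c)
      = P * (P * ((2 / Real.pi) ^ 3 * absVandermonde (a, b, c) / P ^ 2 / 2)) := by
        field_simp
    _ ≤ τ ^ 3 * (P * _) := by
        gcongr
        · exact hPpos.le.trans hτ
        · exact (div_le_div_of_nonneg_right hv two_pos.le).trans hconv

theorem abs_trigDet_add_nat_mul (u : ℝ × ℝ × ℝ) (k : ℕ) :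
    |trigDet (u.1 + k * (Real.pi / 2), u.2.1 + k * (Real.pi / 2), u.2.2 + k * (Real.pi / 2))|
      = |trigDet u| := by
  induction k with
  | zero => simp
  | succ k ih =>
    have e : ∀ x : ℝ, x + ((k + 1 : ℕ) : ℝ) * (Real.pi / 2)
        = x + k * (Real.pi / 2) + Real.pi / 2 := fun x => by push_cast; ring
    rw [← ih, ← abs_neg]
    congr 1
    simp only [e, trigDet, triple, det3, Real.sin_add_pi_div_two, Real.cos_add_pi_div_two]
    ring

theorem volume_prod_le_of_slice {X Y : Type*} [MeasureSpace X] [MeasureSpace Y]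
    [SFinite (volume : Measure Y)] {R : Set (X × Y)}
    (hR : MeasurableSet R) {S : Set X} (hS : MeasurableSet S) {m : ENNReal}
    (hslice : ∀ x ∈ S, volume (Prod.mk x ⁻¹' R) ≤ m) (hsub : ∀ p ∈ R, p.1 ∈ S) :
    volume R ≤ m * volume S := by
  rw [Measure.volume_eq_prod, Measure.prod_apply hR, ← lintegral_indicator_const hS]
  refine lintegral_mono fun x => ?_
  by_cases hx : x ∈ S
  · simpa [hx] using hslice x hx
  · have : Prod.mk x ⁻¹' R = ∅ := by
      ext y
      simp only [mem_preimage, mem_empty_iff_false, iff_false]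
      exact fun h => hx (hsub _ h)
    simp [this]

/-- The alternating sum of `f` over three points. -/
def altSum (f : ℝ → ℝ) (s : ℝ × ℝ × ℝ) : ℝ := f s.1 - f s.2.1 + f s.2.2

/-- The linear functional with alternating coefficients `p`. -/
noncomputable def altRow (p : ℝ × ℝ × ℝ) : ℝ × ℝ × ℝ →L[ℝ] ℝ :=
  p.1 • ContinuousLinearMap.fst ℝ ℝ (ℝ × ℝ)
    - p.2.1 • (ContinuousLinearMap.fst ℝ ℝ ℝ).comp (ContinuousLinearMap.snd ℝ ℝ (ℝ × ℝ))
    + p.2.2 • (ContinuousLinearMap.snd ℝ ℝ ℝ).comp (ContinuousLinearMap.snd ℝ ℝ (ℝ × ℝ))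

theorem altRow_apply (p v : ℝ × ℝ × ℝ) :
    altRow p v = p.1 * v.1 - p.2.1 * v.2.1 + p.2.2 * v.2.2 := by
  simp [altRow]

theorem det_altRow (p q r : ℝ × ℝ × ℝ) :
    ((altRow p).prod ((altRow q).prod (altRow r))).det = -det3 p q r := by
  let e : (ℝ × ℝ × ℝ) ≃ₗ[ℝ] (Fin 3 → ℝ) :=
    { toFun := fun v => ![v.1, v.2.1, v.2.2]
      invFun := fun w => (w 0, w 1, w 2)
      map_add' := fun v w => by ext i; fin_cases i <;> simp
      map_smul' := fun c v => by ext i; fin_cases i <;> simp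
      left_inv := fun v => by simp
      right_inv := fun w => by ext i; fin_cases i <;> simp }
  have h : e.toLinearMap ∘ₗ
      ((altRow p).prod ((altRow q).prod (altRow r)) : ℝ × ℝ × ℝ →L[ℝ] ℝ × ℝ × ℝ).toLinearMap
        ∘ₗ e.symm.toLinearMap
      = Matrix.toLin' !![p.1, -p.2.1, p.2.2; q.1, -q.2.1, q.2.2; r.1, -r.2.1, r.2.2] := by
    refine LinearMap.ext fun w => ?_
    ext i
    fin_cases i <;>
      simp [e, altRow_apply, Matrix.mulVec, dotProduct, Fin.sum_univ_three] <;> ring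
  rw [ContinuousLinearMap.det, ← LinearMap.det_conj _ e, h, LinearMap.det_toLin',
    Matrix.det_fin_three]
  simp [det3]
  ring

theorem hasFDerivAt_altSum {f f' : ℝ → ℝ} {s : ℝ × ℝ × ℝ} (h1 : HasDerivAt f (f' s.1) s.1)
    (h2 : HasDerivAt f (f' s.2.1) s.2.1) (h3 : HasDerivAt f (f' s.2.2) s.2.2) :
    HasFDerivAt (altSum f) (altRow (triple f' s)) s := by
  have e1 := h1.comp_hasFDerivAt s (hasFDerivAt_fst (𝕜 := ℝ) (E := ℝ) (F := ℝ × ℝ) (p := s))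
  have e2 := h2.comp_hasFDerivAt s ((hasFDerivAt_fst (𝕜 := ℝ) (E := ℝ) (F := ℝ)
    (p := s.2)).comp s (hasFDerivAt_snd (𝕜 := ℝ) (E := ℝ) (F := ℝ × ℝ) (p := s)))
  have e3 := h3.comp_hasFDerivAt s ((hasFDerivAt_snd (𝕜 := ℝ) (E := ℝ) (F := ℝ)
    (p := s.2)).comp s (hasFDerivAt_snd (𝕜 := ℝ) (E := ℝ) (F := ℝ × ℝ) (p := s)))
  exact (e1.sub e2).add e3

/-- `f` has derivative `f'` on `J`, and `f'` is bounded by `H` and `H`-Lipschitz on `J`. -/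
structure BoundedC11On (f f' : ℝ → ℝ) (J : Set ℝ) (H : ℝ) : Prop where
  hasDerivAt : ∀ s ∈ J, HasDerivAt f (f' s) s
  abs_le : ∀ s ∈ J, |f' s| ≤ H
  lipschitz : ∀ s ∈ J, ∀ s' ∈ J, |f' s' - f' s| ≤ H * |s' - s|

theorem BoundedC11On.mono {f f' : ℝ → ℝ} {J : Set ℝ} {H H' : ℝ} (h : BoundedC11On f f' J H)
    (hH : H ≤ H') : BoundedC11On f f' J H' :=
  ⟨h.hasDerivAt, fun s hs => (h.abs_le s hs).trans hH,
    fun s hs s' hs' => (h.lipschitz s hs s' hs').trans (by gcongr)⟩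

theorem BoundedC11On.exists_slope {f f' : ℝ → ℝ} {j₀ j₁ H : ℝ}
    (h : BoundedC11On f f' (Icc j₀ j₁) H) {s s' : ℝ} (hs : s ∈ Icc j₀ j₁) (hs' : s' ∈ Icc j₀ j₁) :
    ∃ d, f s' - f s = d * (s' - s) ∧ |d| ≤ H ∧ |d - f' s| ≤ H * |s' - s| := by
  have key : ∃ ξ ∈ Icc j₀ j₁, f s' - f s = f' ξ * (s' - s) ∧ |ξ - s| ≤ |s' - s| := by
    rcases lt_trichotomy s s' with hlt | rfl | hlt
    · have hsub : Icc s s' ⊆ Icc j₀ j₁ := Icc_subset_Icc hs.1 hs'.2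
      obtain ⟨ξ, hξ, he⟩ := exists_hasDerivAt_eq_slope f f' hlt
        (fun x hx => (h.hasDerivAt x (hsub hx)).continuousAt.continuousWithinAt)
        (fun x hx => h.hasDerivAt x (hsub (Ioo_subset_Icc_self hx)))
      refine ⟨ξ, hsub (Ioo_subset_Icc_self hξ), ?_, ?_⟩
      · rw [he, div_mul_cancel₀ _ (by linarith)]
      · rw [abs_of_pos (by linarith [hξ.1]), abs_of_pos (by linarith)]; linarith [hξ.2]
    · exact ⟨s, hs, by simp, by simp⟩
    · have hsub : Icc s' s ⊆ Icc j₀ j₁ := Icc_subset_Icc hs'.1 hs.2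
      obtain ⟨ξ, hξ, he⟩ := exists_hasDerivAt_eq_slope f f' hlt
        (fun x hx => (h.hasDerivAt x (hsub hx)).continuousAt.continuousWithinAt)
        (fun x hx => h.hasDerivAt x (hsub (Ioo_subset_Icc_self hx)))
      refine ⟨ξ, hsub (Ioo_subset_Icc_self hξ), ?_, ?_⟩
      · rw [he, div_mul_eq_mul_div, eq_div_iff (by linarith)]; ring
      · rw [abs_of_neg (by linarith [hξ.2]), abs_of_neg (by linarith)]; linarith [hξ.1]
  obtain ⟨ξ, hξ, h1, h2⟩ := key
  refine ⟨f' ξ, h1, h.abs_le ξ hξ, (h.lipschitz s hs ξ hξ).trans ?_⟩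
  have : 0 ≤ H := (abs_nonneg _).trans (h.abs_le s hs)
  gcongr

theorem abs_mul_mul_sub_le {x y z x' y' z' X Y Z ρ : ℝ} (hx : |x| ≤ X) (hy' : |y'| ≤ Y)
    (hy : |y| ≤ Y) (hz' : |z'| ≤ Z) (hdx : |x' - x| ≤ X * ρ)
    (hdy : |y' - y| ≤ Y * ρ) (hdz : |z' - z| ≤ Z * ρ) :
    |x' * y' * z' - x * y * z| ≤ 3 * (X * Y * Z * ρ) := by
  have hX := (abs_nonneg _).trans hx
  have hY := (abs_nonneg _).trans hy
  have hZ := (abs_nonneg _).trans hz'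
  have e : x' * y' * z' - x * y * z
      = (x' - x) * y' * z' + x * (y' - y) * z' + x * y * (z' - z) := by ring
  have h1 : |(x' - x) * y' * z'| ≤ X * ρ * Y * Z := by
    rw [abs_mul, abs_mul]
    have := (abs_nonneg _).trans hdx
    gcongr
  have h2 : |x * (y' - y) * z'| ≤ X * (Y * ρ) * Z := by
    rw [abs_mul, abs_mul]
    have := (abs_nonneg _).trans hdy
    gcongr
  have h3 : |x * y * (z' - z)| ≤ X * Y * (Z * ρ) := by
    rw [abs_mul, abs_mul]; gcongr
  rw [e]
  calc _ ≤ |(x' - x) * y' * z'| + |x * (y' - y) * z'| + |x * y * (z' - z)| := abs_add_three _ _ _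
    _ ≤ _ := by linarith

theorem abs_det3_sub_le {p q r p' q' r' : ℝ × ℝ × ℝ} {X Y Z ρ : ℝ}
    (hp : |p.1| ≤ X ∧ |p.2.1| ≤ X ∧ |p.2.2| ≤ X)
    (hq : |q.1| ≤ Y ∧ |q.2.1| ≤ Y ∧ |q.2.2| ≤ Y) (hq' : |q'.1| ≤ Y ∧ |q'.2.1| ≤ Y ∧ |q'.2.2| ≤ Y)
    (hr' : |r'.1| ≤ Z ∧ |r'.2.1| ≤ Z ∧ |r'.2.2| ≤ Z)
    (hdp : |p'.1 - p.1| ≤ X * ρ ∧ |p'.2.1 - p.2.1| ≤ X * ρ ∧ |p'.2.2 - p.2.2| ≤ X * ρ)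
    (hdq : |q'.1 - q.1| ≤ Y * ρ ∧ |q'.2.1 - q.2.1| ≤ Y * ρ ∧ |q'.2.2 - q.2.2| ≤ Y * ρ)
    (hdr : |r'.1 - r.1| ≤ Z * ρ ∧ |r'.2.1 - r.2.1| ≤ Z * ρ ∧ |r'.2.2 - r.2.2| ≤ Z * ρ) :
    |det3 p' q' r' - det3 p q r| ≤ 18 * (X * Y * Z * ρ) := by
  obtain ⟨p1, p2, p3⟩ := hp
  obtain ⟨q1, q2, q3⟩ := hq
  obtain ⟨q1', q2', q3'⟩ := hq'
  obtain ⟨r1', r2', r3'⟩ := hr'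
  obtain ⟨dp1, dp2, dp3⟩ := hdp
  obtain ⟨dq1, dq2, dq3⟩ := hdq
  obtain ⟨dr1, dr2, dr3⟩ := hdr
  have t1 := abs_le.1 (abs_mul_mul_sub_le p1 q2' q2 r3' dp1 dq2 dr3)
  have t2 := abs_le.1 (abs_mul_mul_sub_le p1 q3' q3 r2' dp1 dq3 dr2)
  have t3 := abs_le.1 (abs_mul_mul_sub_le p2 q1' q1 r3' dp2 dq1 dr3)
  have t4 := abs_le.1 (abs_mul_mul_sub_le p2 q3' q3 r1' dp2 dq3 dr1)
  have t5 := abs_le.1 (abs_mul_mul_sub_le p3 q1' q1 r2' dp3 dq1 dr2)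
  have t6 := abs_le.1 (abs_mul_mul_sub_le p3 q2' q2 r1' dp3 dq2 dr1)
  simp only [det3]
  rw [abs_le]
  constructor <;> linarith [t1.1, t1.2, t2.1, t2.2, t3.1, t3.2, t4.1, t4.2, t5.1, t5.2, t6.1, t6.2]

theorem eq_zero_of_altRow_eq_zero {p q r d : ℝ × ℝ × ℝ} (hdet : det3 p q r ≠ 0)
    (hp : altRow p d = 0) (hq : altRow q d = 0) (hr : altRow r d = 0) : d = 0 := by
  rw [altRow_apply] at hp hq hr
  have h1 : det3 p q r * d.1 = 0 := by
    simp only [det3]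
    linear_combination (q.2.1 * r.2.2 - q.2.2 * r.2.1) * hp
      - (p.2.1 * r.2.2 - p.2.2 * r.2.1) * hq + (p.2.1 * q.2.2 - p.2.2 * q.2.1) * hr
  have h2 : det3 p q r * d.2.1 = 0 := by
    simp only [det3]
    linear_combination (q.1 * r.2.2 - q.2.2 * r.1) * hp
      - (p.1 * r.2.2 - p.2.2 * r.1) * hq + (p.1 * q.2.2 - p.2.2 * q.1) * hr
  have h3 : det3 p q r * d.2.2 = 0 := by
    simp only [det3]
    linear_combination (q.1 * r.2.1 - q.2.1 * r.1) * hp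
      - (p.1 * r.2.1 - p.2.1 * r.1) * hq + (p.1 * q.2.1 - p.2.1 * q.1) * hr
  exact Prod.ext ((mul_eq_zero.1 h1).resolve_left hdet)
    (Prod.ext ((mul_eq_zero.1 h2).resolve_left hdet) ((mul_eq_zero.1 h3).resolve_left hdet))

theorem abs_altSum_sub_le {f f' : ℝ → ℝ} {j₀ j₁ H ρ : ℝ}
    (h : BoundedC11On f f' (Icc j₀ j₁) H) {s s' : ℝ × ℝ × ℝ}
    (h1 : s.1 ∈ Icc j₀ j₁) (h2 : s.2.1 ∈ Icc j₀ j₁) (h3 : s.2.2 ∈ Icc j₀ j₁)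
    (h1' : s'.1 ∈ Icc j₀ j₁) (h2' : s'.2.1 ∈ Icc j₀ j₁) (h3' : s'.2.2 ∈ Icc j₀ j₁)
    (d1 : |s'.1 - s.1| ≤ ρ) (d2 : |s'.2.1 - s.2.1| ≤ ρ) (d3 : |s'.2.2 - s.2.2| ≤ ρ) :
    |altSum f s' - altSum f s| ≤ 3 * H * ρ := by
  have key : ∀ x ∈ Icc j₀ j₁, ∀ x' ∈ Icc j₀ j₁, |x' - x| ≤ ρ → |f x' - f x| ≤ H * ρ := by
    intro x hx y hy hd
    obtain ⟨d, hd1, hd2, -⟩ := h.exists_slope hx hy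
    rw [hd1, abs_mul]
    have := (abs_nonneg _).trans hd2
    gcongr
  have k1 := abs_le.1 (key _ h1 _ h1' d1)
  have k2 := abs_le.1 (key _ h2 _ h2' d2)
  have k3 := abs_le.1 (key _ h3 _ h3' d3)
  simp only [altSum]
  rw [abs_le]
  constructor <;> linarith [k1.1, k1.2, k2.1, k2.2, k3.1, k3.2]

section Core

variable {a a' b b' l l' : ℝ → ℝ} {j₀ j₁ H M : ℝ}

theorem injOn_altSum (ha : BoundedC11On a a' (Icc j₀ j₁) H) (hb : BoundedC11On b b' (Icc j₀ j₁) H)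
    (hl : BoundedC11On l l' (Icc j₀ j₁) M) {S : Set (ℝ × ℝ × ℝ)} {ρ κ : ℝ}
    (hS : S ⊆ Icc j₀ j₁ ×ˢ (Icc j₀ j₁ ×ˢ Icc j₀ j₁))
    (hdiam : ∀ s ∈ S, ∀ s' ∈ S,
      |s'.1 - s.1| ≤ ρ ∧ |s'.2.1 - s.2.1| ≤ ρ ∧ |s'.2.2 - s.2.2| ≤ ρ)
    (hdet : ∀ s ∈ S, κ ≤ |det3 (triple a' s) (triple b' s) (triple l' s)|)
    (hρ : 18 * (H * H * M * ρ) < κ) :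
    InjOn (fun s => (altSum a s, altSum b s, altSum l s)) S := by
  intro s hs s' hs' heq
  obtain ⟨h1, h2, h3⟩ := hS hs
  obtain ⟨h1', h2', h3'⟩ := hS hs'
  obtain ⟨d1, d2, d3⟩ := hdiam s hs s' hs'
  have step : ∀ {f f' : ℝ → ℝ} {G : ℝ}, BoundedC11On f f' (Icc j₀ j₁) G →
      altSum f s = altSum f s' → ∃ p : ℝ × ℝ × ℝ, altRow p (s' - s) = 0 ∧
        (|p.1| ≤ G ∧ |p.2.1| ≤ G ∧ |p.2.2| ≤ G) ∧
        (|(triple f' s).1| ≤ G ∧ |(triple f' s).2.1| ≤ G ∧ |(triple f' s).2.2| ≤ G) ∧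
        (|p.1 - (triple f' s).1| ≤ G * ρ ∧ |p.2.1 - (triple f' s).2.1| ≤ G * ρ ∧
          |p.2.2 - (triple f' s).2.2| ≤ G * ρ) := by
    intro f f' G hf he
    obtain ⟨x1, e1, b1, c1⟩ := hf.exists_slope h1 h1'
    obtain ⟨x2, e2, b2, c2⟩ := hf.exists_slope h2 h2'
    obtain ⟨x3, e3, b3, c3⟩ := hf.exists_slope h3 h3'
    have hG : 0 ≤ G := (abs_nonneg _).trans b1
    refine ⟨(x1, x2, x3), ?_, ⟨b1, b2, b3⟩,
      ⟨hf.abs_le _ h1, hf.abs_le _ h2, hf.abs_le _ h3⟩,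
      c1.trans (by gcongr), c2.trans (by gcongr), c3.trans (by gcongr)⟩
    rw [altRow_apply]
    simp only [altSum] at he
    simp only [Prod.fst_sub, Prod.snd_sub]
    linarith
  simp only [Prod.mk.injEq] at heq
  obtain ⟨p, p0, -, pb', pd⟩ := step ha heq.1
  obtain ⟨q, q0, qb, qb', qd⟩ := step hb heq.2.1
  obtain ⟨r, r0, rb, -, rd⟩ := step hl heq.2.2
  have hsub := abs_det3_sub_le pb' qb' qb rb pd qd rd
  have hne : det3 p q r ≠ 0 := by
    intro h0
    rw [h0, zero_sub, abs_neg] at hsub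
    linarith [hdet s hs]
  exact (sub_eq_zero.1 (eq_zero_of_altRow_eq_zero hne p0 q0 r0)).symm

theorem volume_graph_slab_le {φ : ℝ × ℝ → ℝ} (hφ : Measurable φ) (c₁ c₂ : ℝ) {w r : ℝ}
    (hw : 0 ≤ w) :
    volume {g : ℝ × ℝ × ℝ | |g.1 - c₁| ≤ w ∧ |g.2.1 - c₂| ≤ w ∧ |g.2.2 - φ (g.1, g.2.1)| ≤ r}
      ≤ ENNReal.ofReal (2 * r * (2 * w) * (2 * w)) := by
  have hI : ∀ c v : ℝ, volume {x : ℝ | |x - c| ≤ v} = ENNReal.ofReal (2 * v) := fun c v => by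
    have : {x : ℝ | |x - c| ≤ v} = Metric.closedBall c v := by
      ext x; simp [Real.dist_eq]
    rw [this, Real.volume_closedBall]
  have hmI : ∀ c v : ℝ, MeasurableSet {x : ℝ | |x - c| ≤ v} := fun c v =>
    measurableSet_le (by fun_prop) measurable_const
  have hmeas : MeasurableSet
      {g : ℝ × ℝ × ℝ | |g.1 - c₁| ≤ w ∧ |g.2.1 - c₂| ≤ w ∧ |g.2.2 - φ (g.1, g.2.1)| ≤ r} := by
    simp only [ofPred_and]
    refine (measurableSet_le ?_ measurable_const).inter
      ((measurableSet_le ?_ measurable_const).inter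
        (measurableSet_le ?_ measurable_const)) <;> fun_prop
  have hslice : ∀ x : ℝ, volume (Prod.mk x ⁻¹'
      {g : ℝ × ℝ × ℝ | |g.1 - c₁| ≤ w ∧ |g.2.1 - c₂| ≤ w ∧ |g.2.2 - φ (g.1, g.2.1)| ≤ r})
      ≤ ENNReal.ofReal (2 * r) * ENNReal.ofReal (2 * w) := by
    intro x
    rw [← hI c₂ w]
    refine volume_prod_le_of_slice (measurable_prodMk_left hmeas) (hmI c₂ w) ?_ ?_
    · intro y _
      rw [← hI (φ (x, y)) r]
      exact measure_mono fun z hz => hz.2.2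
    · exact fun p hp => hp.2.1
  have := volume_prod_le_of_slice hmeas (hmI c₁ w) (fun x _ => hslice x) (fun p hp => hp.1)
  rwa [hI, ← ENNReal.ofReal_mul' (by positivity), ← ENNReal.ofReal_mul' (by positivity)] at this

theorem volume_small_piece_le (ha : BoundedC11On a a' (Icc j₀ j₁) H)
    (hb : BoundedC11On b b' (Icc j₀ j₁) H)
    (hl : BoundedC11On l l' (Icc j₀ j₁) M) {S : Set (ℝ × ℝ × ℝ)} {ρ κ r : ℝ}
    (hSm : MeasurableSet S)
    (hS : S ⊆ Icc j₀ j₁ ×ˢ (Icc j₀ j₁ ×ˢ Icc j₀ j₁))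
    (hdiam : ∀ s ∈ S, ∀ s' ∈ S,
      |s'.1 - s.1| ≤ ρ ∧ |s'.2.1 - s.2.1| ≤ ρ ∧ |s'.2.2 - s.2.2| ≤ ρ)
    (hdet : ∀ s ∈ S, κ ≤ |det3 (triple a' s) (triple b' s) (triple l' s)|)
    (hρ : 18 * (H * H * M * ρ) < κ) (hκ : 0 < κ)
    {φ : ℝ × ℝ → ℝ} (hφ : Measurable φ)
    (hsub : ∀ s ∈ S, |altSum l s - φ (altSum a s, altSum b s)| ≤ r) :
    volume S ≤ ENNReal.ofReal (72 * H ^ 2 * ρ ^ 2 * r / κ) := by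
  rcases S.eq_empty_or_nonempty with rfl | ⟨s₀, hs₀⟩
  · simp
  have hρ0 : 0 ≤ ρ := (abs_nonneg _).trans (hdiam s₀ hs₀ s₀ hs₀).1
  have hH : 0 ≤ H := (abs_nonneg _).trans (ha.abs_le _ (hS hs₀).1)
  have hr : 0 ≤ r := (abs_nonneg _).trans (hsub _ hs₀)
  have h₂ : (volume : Measure (ℝ × ℝ)).IsAddHaarMeasure :=
    Measure.prod.instIsAddHaarMeasure volume volume
  have h₃ : (volume : Measure (ℝ × ℝ × ℝ)).IsAddHaarMeasure :=
    Measure.prod.instIsAddHaarMeasure volume volume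
  have hcv := lintegral_abs_det_fderiv_eq_addHaar_image volume hSm
    (f := fun s => (altSum a s, altSum b s, altSum l s))
    (f' := fun s => (altRow (triple a' s)).prod ((altRow (triple b' s)).prod
      (altRow (triple l' s))))
    (fun s hs => by
      obtain ⟨h1, h2, h3⟩ := hS hs
      exact ((hasFDerivAt_altSum (ha.hasDerivAt _ h1) (ha.hasDerivAt _ h2)
        (ha.hasDerivAt _ h3)).prodMk ((hasFDerivAt_altSum (hb.hasDerivAt _ h1)
        (hb.hasDerivAt _ h2) (hb.hasDerivAt _ h3)).prodMk (hasFDerivAt_altSum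
        (hl.hasDerivAt _ h1) (hl.hasDerivAt _ h2) (hl.hasDerivAt _ h3)))).hasFDerivWithinAt)
    (injOn_altSum ha hb hl hS hdiam hdet hρ)
  have hlow : ENNReal.ofReal κ * volume S
      ≤ volume ((fun s => (altSum a s, altSum b s, altSum l s)) '' S) := by
    rw [← setLIntegral_const]
    refine le_trans (setLIntegral_mono' hSm fun s hs => ?_) hcv.le
    rw [det_altRow, abs_neg]
    exact ENNReal.ofReal_le_ofReal (hdet s hs)
  have himg : (fun s => (altSum a s, altSum b s, altSum l s)) '' S ⊆
      {g : ℝ × ℝ × ℝ | |g.1 - altSum a s₀| ≤ 3 * H * ρ ∧ |g.2.1 - altSum b s₀| ≤ 3 * H * ρ ∧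
        |g.2.2 - φ (g.1, g.2.1)| ≤ r} := by
    rintro _ ⟨s, hs, rfl⟩
    obtain ⟨h1, h2, h3⟩ := hS hs₀
    obtain ⟨h1', h2', h3'⟩ := hS hs
    obtain ⟨d1, d2, d3⟩ := hdiam s₀ hs₀ s hs
    exact ⟨abs_altSum_sub_le ha h1 h2 h3 h1' h2' h3' d1 d2 d3,
      abs_altSum_sub_le hb h1 h2 h3 h1' h2' h3' d1 d2 d3, hsub s hs⟩
  have hup := hlow.trans ((measure_mono himg).trans
    (volume_graph_slab_le hφ _ _ (by positivity)))
  have hκ' : ENNReal.ofReal κ ≠ 0 := by simpa using hκ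
  rw [mul_comm, ← ENNReal.le_div_iff_mul_le (Or.inl hκ') (Or.inl ENNReal.ofReal_ne_top),
    ← ENNReal.ofReal_div_of_pos hκ] at hup
  refine hup.trans (le_of_eq ?_)
  congr 2
  ring

theorem exists_mem_Icc_subdivision {n : ℕ} (hn : 0 < n) {s : ℝ} (hs : s ∈ Icc (1 : ℝ) 2) :
    ∃ i ∈ Finset.range n, s ∈ Icc (1 + (i : ℝ) / n) (1 + (i : ℝ) / n + 1 / n) := by
  have hn' : (0 : ℝ) < n := by exact_mod_cast hn
  rcases eq_or_lt_of_le hs.2 with rfl | h2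
  · refine ⟨n - 1, by simp; omega, ?_⟩
    rw [Nat.cast_sub (by omega)]
    constructor
    · rw [Nat.cast_one, sub_div, div_self hn'.ne']
      have : 0 < 1 / (n : ℝ) := by positivity
      linarith
    · rw [Nat.cast_one, sub_div, div_self hn'.ne']
      linarith
  · have h0 : 0 ≤ (s - 1) * n := mul_nonneg (by linarith [hs.1]) hn'.le
    refine ⟨⌊(s - 1) * n⌋₊, ?_, ?_, ?_⟩
    · rw [Finset.mem_range, Nat.floor_lt h0]
      nlinarith
    · have := Nat.floor_le h0
      have h3 : (⌊(s - 1) * n⌋₊ : ℝ) / n ≤ s - 1 := by rwa [div_le_iff₀ hn']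
      linarith
    · have := (Nat.lt_floor_add_one ((s - 1) * n)).le
      have h3 : s - 1 ≤ ((⌊(s - 1) * n⌋₊ : ℝ) + 1) / n := by rwa [le_div_iff₀ hn']
      rw [add_div] at h3
      linarith

theorem volume_nearDiagonal_le {η : ℝ} (hη : 0 ≤ η) :
    volume {s : ℝ × ℝ × ℝ | s ∈ Icc (1 : ℝ) 2 ×ˢ (Icc (1 : ℝ) 2 ×ˢ Icc (1 : ℝ) 2) ∧
      (|s.1 - s.2.1| < η ∨ |s.2.1 - s.2.2| < η ∨ |s.1 - s.2.2| < η)}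
      ≤ ENNReal.ofReal (6 * η) := by
  have hI : ∀ c : ℝ, volume {x : ℝ | |c - x| < η} = ENNReal.ofReal (2 * η) := fun c => by
    have : {x : ℝ | |c - x| < η} = Metric.ball c η := by
      ext x; simp [Real.dist_eq, abs_sub_comm]
    rw [this, Real.volume_ball]
  have hJ : volume (Icc (1 : ℝ) 2) = 1 := by rw [Real.volume_Icc]; norm_num
  have hJm : MeasurableSet (Icc (1 : ℝ) 2) := measurableSet_Icc
  have h2 : volume {p : ℝ × ℝ | p.1 ∈ Icc (1 : ℝ) 2 ∧ p.2 ∈ Icc (1 : ℝ) 2 ∧ |p.1 - p.2| < η}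
      ≤ ENNReal.ofReal (2 * η) := by
    have hm : MeasurableSet
        {p : ℝ × ℝ | p.1 ∈ Icc (1 : ℝ) 2 ∧ p.2 ∈ Icc (1 : ℝ) 2 ∧ |p.1 - p.2| < η} := by
      simp only [ofPred_and]
      refine (measurable_fst hJm).inter ((measurable_snd hJm).inter
        (measurableSet_lt ?_ measurable_const))
      fun_prop
    refine (volume_prod_le_of_slice hm hJm (m := ENNReal.ofReal (2 * η)) (fun x _ => ?_)
      (fun p hp => hp.1)).trans (by rw [hJ, mul_one])
    rw [← hI x]
    exact measure_mono fun y hy => hy.2.2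
  have m1 : MeasurableSet {s : ℝ × ℝ × ℝ | s ∈ Icc (1 : ℝ) 2 ×ˢ (Icc (1 : ℝ) 2 ×ˢ Icc (1 : ℝ) 2) ∧
      |s.1 - s.2.1| < η} := by
    simp only [ofPred_and]
    refine (hJm.prod (hJm.prod hJm)).inter (measurableSet_lt ?_ measurable_const)
    fun_prop
  have m2 : MeasurableSet {s : ℝ × ℝ × ℝ | s ∈ Icc (1 : ℝ) 2 ×ˢ (Icc (1 : ℝ) 2 ×ˢ Icc (1 : ℝ) 2) ∧
      |s.2.1 - s.2.2| < η} := by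
    simp only [ofPred_and]
    refine (hJm.prod (hJm.prod hJm)).inter (measurableSet_lt ?_ measurable_const)
    fun_prop
  have m3 : MeasurableSet {s : ℝ × ℝ × ℝ | s ∈ Icc (1 : ℝ) 2 ×ˢ (Icc (1 : ℝ) 2 ×ˢ Icc (1 : ℝ) 2) ∧
      |s.1 - s.2.2| < η} := by
    simp only [ofPred_and]
    refine (hJm.prod (hJm.prod hJm)).inter (measurableSet_lt ?_ measurable_const)
    fun_prop
  have v1 := volume_prod_le_of_slice m1 hJm (m := ENNReal.ofReal (2 * η))
    (fun x _ => (measure_mono (t := {y : ℝ | |x - y| < η} ×ˢ Icc (1 : ℝ) 2)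
      (fun y hy => ⟨hy.2, hy.1.2.2⟩)).trans (by
        rw [Measure.volume_eq_prod, Measure.prod_prod, hI, hJ, mul_one])) (fun p hp => hp.1.1)
  have v2 := volume_prod_le_of_slice m2 hJm (m := ENNReal.ofReal (2 * η))
    (fun x _ => by
      refine le_trans (measure_mono ?_) h2
      exact fun y hy => ⟨hy.1.2.1, hy.1.2.2, hy.2⟩)
    (fun p hp => hp.1.1)
  have v3 := volume_prod_le_of_slice m3 hJm (m := ENNReal.ofReal (2 * η))
    (fun x _ => (measure_mono (t := Icc (1 : ℝ) 2 ×ˢ {y : ℝ | |x - y| < η})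
      (fun y hy => ⟨hy.1.2.1, hy.2⟩)).trans (by
        rw [Measure.volume_eq_prod, Measure.prod_prod, hI, hJ, one_mul])) (fun p hp => hp.1.1)
  rw [hJ, mul_one] at v1 v2 v3
  refine (measure_mono (t := _ ∪ (_ ∪ _)) ?_).trans ((measure_union_le _ _).trans
    ((add_le_add v1 ((measure_union_le _ _).trans (add_le_add v2 v3))).trans (le_of_eq ?_)))
  · rintro s ⟨hs, h | h | h⟩
    · exact Or.inl ⟨hs, h⟩
    · exact Or.inr (Or.inl ⟨hs, h⟩)
    · exact Or.inr (Or.inr ⟨hs, h⟩)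
  · rw [← ENNReal.ofReal_add (by positivity) (by positivity),
      ← ENNReal.ofReal_add (by positivity) (by positivity)]
    congr 1
    ring

/-- The values of `l` alternating-summed over three points are not, up to small errors, a function
of the alternating sums of `a` and `b`, outside a small set of triples. -/
theorem volume_altSum_sublevel_le (ha : BoundedC11On a a' (Icc j₀ j₁) H)
    (hb : BoundedC11On b b' (Icc j₀ j₁) H) (hl : BoundedC11On l l' (Icc j₀ j₁) M)
    (hj₀ : 1 ≤ j₀) (hj₁ : j₁ ≤ 2) (hH : 1 ≤ H) (hM : 1 ≤ M) {c η r : ℝ} (hc : 0 < c) (hc1 : c ≤ 1)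
    (hη : 0 < η) (hη1 : η ≤ 1) (hr : 0 ≤ r)
    (hdet : ∀ s ∈ Icc j₀ j₁ ×ˢ (Icc j₀ j₁ ×ˢ Icc j₀ j₁),
      c * absVandermonde s ≤ |det3 (triple a' s) (triple b' s) (triple l' s)|)
    {φ : ℝ × ℝ → ℝ} (hφ : Measurable φ) {T : Set (ℝ × ℝ × ℝ)} (hT : MeasurableSet T)
    (hTJ : T ⊆ Icc j₀ j₁ ×ˢ (Icc j₀ j₁ ×ˢ Icc j₀ j₁))
    (hsub : ∀ s ∈ T, |altSum l s - φ (altSum a s, altSum b s)| ≤ r) :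
    volume T ≤ ENNReal.ofReal (6 * η + 1368 * H ^ 4 * M * r / (c ^ 2 * η ^ 6)) := by
  set κ := c * η ^ 3 with hκdef
  have hκ : 0 < κ := by positivity
  have hκ1 : κ ≤ 1 := mul_le_one₀ hc1 (by positivity) (pow_le_one₀ hη.le hη1)
  have hHM : 1 ≤ H * H * M := by
    have := one_le_mul_of_one_le_of_one_le hH hH
    exact one_le_mul_of_one_le_of_one_le this hM
  set n := ⌊18 * (H * H * M) / κ⌋₊ + 1 with hn
  have hn0 : 0 < n := Nat.succ_pos _
  have hnR : (0 : ℝ) < n := by exact_mod_cast hn0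
  have hn1 : 18 * (H * H * M) / κ < n := by rw [hn]; push_cast; exact Nat.lt_floor_add_one _
  have hn2 : (n : ℝ) ≤ 19 * (H * H * M) / κ := by
    have h1 : (⌊18 * (H * H * M) / κ⌋₊ : ℝ) ≤ 18 * (H * H * M) / κ := Nat.floor_le (by positivity)
    have h2 : 1 ≤ H * H * M / κ := by rw [le_div_iff₀ hκ]; linarith
    rw [hn]; push_cast
    calc _ ≤ 18 * (H * H * M) / κ + H * H * M / κ := add_le_add h1 h2
      _ = _ := by ring
  have hρ : 18 * (H * H * M * (1 / n)) < κ := by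
    rw [div_lt_iff₀ hκ] at hn1
    calc 18 * (H * H * M * (1 / n)) = 18 * (H * H * M) / n := by ring
      _ < κ := by rw [div_lt_iff₀ hnR]; linarith
  let I : ℕ → Set ℝ := fun i => Icc (1 + (i : ℝ) / n) (1 + (i : ℝ) / n + 1 / n)
  let N : Set (ℝ × ℝ × ℝ) := {s | s ∈ Icc (1 : ℝ) 2 ×ˢ (Icc (1 : ℝ) 2 ×ˢ Icc (1 : ℝ) 2) ∧
      (|s.1 - s.2.1| < η ∨ |s.2.1 - s.2.2| < η ∨ |s.1 - s.2.2| < η)}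
  let P : ℕ × ℕ × ℕ → Set (ℝ × ℝ × ℝ) := fun i =>
    (T ∩ {s | η ≤ |s.1 - s.2.1| ∧ η ≤ |s.2.1 - s.2.2| ∧ η ≤ |s.1 - s.2.2|})
      ∩ (I i.1 ×ˢ (I i.2.1 ×ˢ I i.2.2))
  let F := Finset.range n ×ˢ (Finset.range n ×ˢ Finset.range n)
  have hIm : ∀ i, MeasurableSet (I i) := fun i => measurableSet_Icc
  have hPm : ∀ i, MeasurableSet (P i) := fun i => by
    refine (hT.inter ?_).inter ((hIm _).prod ((hIm _).prod (hIm _)))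
    simp only [ofPred_and]
    refine (measurableSet_le measurable_const ?_).inter
      ((measurableSet_le measurable_const ?_).inter
        (measurableSet_le measurable_const ?_)) <;> fun_prop
  have hId : ∀ i, ∀ x ∈ I i, ∀ y ∈ I i, |y - x| ≤ 1 / n := fun i x hx y hy =>
    abs_le.2 ⟨by linarith [hx.2, hy.1], by linarith [hx.1, hy.2]⟩
  have hPv : ∀ i, volume (P i) ≤ ENNReal.ofReal (72 * H ^ 2 * (1 / n) ^ 2 * r / κ) := by
    intro i
    refine volume_small_piece_le ha hb hl (hPm i) (fun s hs => hTJ hs.1.1) ?_ ?_ hρ hκ hφ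
      (fun s hs => hsub s hs.1.1)
    · exact fun s hs s' hs' => ⟨hId _ _ hs.2.1 _ hs'.2.1, hId _ _ hs.2.2.1 _ hs'.2.2.1,
        hId _ _ hs.2.2.2 _ hs'.2.2.2⟩
    · intro s hs
      refine le_trans ?_ (hdet s (hTJ hs.1.1))
      obtain ⟨g1, g2, g3⟩ := hs.1.2
      rw [hκdef, absVandermonde]
      calc c * η ^ 3 = c * (η * η * η) := by ring
        _ ≤ _ := by gcongr
  have hJ12 : Icc j₀ j₁ ⊆ Icc (1 : ℝ) 2 := Icc_subset_Icc hj₀ hj₁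
  have hcover : T ⊆ N ∪ ⋃ i ∈ F, P i := by
    intro s hs
    obtain ⟨h1, h2, h3⟩ := hTJ hs
    by_cases hg : η ≤ |s.1 - s.2.1| ∧ η ≤ |s.2.1 - s.2.2| ∧ η ≤ |s.1 - s.2.2|
    · obtain ⟨i1, hi1, m1⟩ := exists_mem_Icc_subdivision hn0 (hJ12 h1)
      obtain ⟨i2, hi2, m2⟩ := exists_mem_Icc_subdivision hn0 (hJ12 h2)
      obtain ⟨i3, hi3, m3⟩ := exists_mem_Icc_subdivision hn0 (hJ12 h3)
      refine Or.inr (mem_biUnion (x := (i1, i2, i3)) ?_ ⟨⟨hs, hg⟩, m1, m2, m3⟩)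
      exact Finset.mem_coe.2 (Finset.mk_mem_product hi1 (Finset.mk_mem_product hi2 hi3))
    · refine Or.inl ⟨⟨hJ12 h1, hJ12 h2, hJ12 h3⟩, ?_⟩
      by_contra hcon
      push Not at hcon
      exact hg hcon
  have hcard : F.card = n * (n * n) := by simp [F]
  calc volume T ≤ volume N + volume (⋃ i ∈ F, P i) :=
        (measure_mono hcover).trans (measure_union_le _ _)
    _ ≤ ENNReal.ofReal (6 * η)
        + ∑ i ∈ F, ENNReal.ofReal (72 * H ^ 2 * (1 / n) ^ 2 * r / κ) :=
        add_le_add (volume_nearDiagonal_le hη.le)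
          ((measure_biUnion_finset_le _ _).trans (Finset.sum_le_sum fun i _ => hPv i))
    _ = ENNReal.ofReal (6 * η + n * (72 * H ^ 2 * r / κ)) := by
        rw [Finset.sum_const, hcard, nsmul_eq_mul, ← ENNReal.ofReal_natCast,
          ← ENNReal.ofReal_mul (by positivity), ← ENNReal.ofReal_add (by positivity)
            (by positivity)]
        congr 2
        push_cast
        field_simp
    _ ≤ _ := by
        refine ENNReal.ofReal_le_ofReal ?_
        have : (n : ℝ) * (72 * H ^ 2 * r / κ) ≤ 19 * (H * H * M) / κ * (72 * H ^ 2 * r / κ) := by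
          gcongr
        have e : 19 * (H * H * M) / κ * (72 * H ^ 2 * r / κ)
            = 1368 * H ^ 4 * M * r / (c ^ 2 * η ^ 6) := by
          rw [hκdef]; field_simp; ring
        linarith

end Core

/-- The parameters `s` of the paths with three edges starting at `p`, in the bipartite graph with
an edge from `p` to `p + v t` for every `(p, t) ∈ E`. -/
def pathSet (E : Set ((ℝ × ℝ) × ℝ)) (v : ℝ → ℝ × ℝ) (p : ℝ × ℝ) : Set (ℝ × ℝ × ℝ) :=
  {s | (p, s.1) ∈ E ∧ (p + v s.1 - v s.2.1, s.2.1) ∈ E ∧ (p + v s.1 - v s.2.1, s.2.2) ∈ E}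

section Paths

variable {E : Set ((ℝ × ℝ) × ℝ)} {v : ℝ → ℝ × ℝ}

theorem measurableSet_pathSet (hE : MeasurableSet E) (hv : Measurable v) (p : ℝ × ℝ) :
    MeasurableSet (pathSet E v p) := by
  have h1 : Measurable fun s : ℝ × ℝ × ℝ => (p, s.1) := by fun_prop
  have h2 : Measurable fun s : ℝ × ℝ × ℝ => (p + v s.1 - v s.2.1, s.2.1) := by fun_prop
  have h3 : Measurable fun s : ℝ × ℝ × ℝ => (p + v s.1 - v s.2.1, s.2.2) := by fun_prop
  exact (h1 hE).inter ((h2 hE).inter (h3 hE))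

/-- The measure of the set of edges at the vertex `p` of the first class. -/
noncomputable def outDegree (E : Set ((ℝ × ℝ) × ℝ)) (p : ℝ × ℝ) : ENNReal :=
  volume {t | (p, t) ∈ E}

/-- The measure of the set of edges at the vertex `q` of the second class. -/
noncomputable def inDegree (E : Set ((ℝ × ℝ) × ℝ)) (v : ℝ → ℝ × ℝ) (q : ℝ × ℝ) : ENNReal :=
  volume {t | (q - v t, t) ∈ E}

theorem measurable_outDegree (hE : MeasurableSet E) : Measurable (outDegree E) :=
  measurable_measure_prodMk_left hE

theorem measurable_inDegree (hE : MeasurableSet E) (hv : Measurable v) :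
    Measurable (inDegree E v) := by
  have h : Measurable fun x : (ℝ × ℝ) × ℝ => (x.1 - v x.2, x.2) := by fun_prop
  exact measurable_measure_prodMk_left (h hE)

theorem lintegral_indicator_outDegree (hE : MeasurableSet E) (p : ℝ × ℝ) :
    ∫⁻ t, E.indicator (fun _ => (1 : ENNReal)) (p, t) = outDegree E p := by
  have h : MeasurableSet {t | (p, t) ∈ E} := measurable_prodMk_left hE
  rw [outDegree, ← lintegral_indicator_one h]
  rfl

theorem lintegral_indicator_inDegree (hE : MeasurableSet E) (hv : Measurable v) (q : ℝ × ℝ) :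
    ∫⁻ t, E.indicator (fun _ => (1 : ENNReal)) (q - v t, t) = inDegree E v q := by
  have hm : Measurable fun t : ℝ => (q - v t, t) := by fun_prop
  have h : MeasurableSet {t | (q - v t, t) ∈ E} := hm hE
  rw [inDegree, ← lintegral_indicator_one h]
  rfl

theorem volume_pathSet (hE : MeasurableSet E) (hv : Measurable v) (p : ℝ × ℝ) :
    volume (pathSet E v p) = ∫⁻ τ : ℝ × ℝ, E.indicator (fun _ => (1 : ENNReal)) (p, τ.1) *
      (E.indicator (fun _ => (1 : ENNReal)) (p + v τ.1 - v τ.2, τ.2) *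
        outDegree E (p + v τ.1 - v τ.2)) := by
  have he : Measurable (E.indicator fun _ => (1 : ENNReal)) := measurable_const.indicator hE
  have hd := measurable_outDegree hE
  have hm := measurableSet_pathSet hE hv p
  have hmeas : Measurable fun τ : ℝ × ℝ => E.indicator (fun _ => (1 : ENNReal)) (p, τ.1) *
      (E.indicator (fun _ => (1 : ENNReal)) (p + v τ.1 - v τ.2, τ.2) *
        outDegree E (p + v τ.1 - v τ.2)) := by fun_prop
  rw [Measure.volume_eq_prod, Measure.prod_apply hm, Measure.volume_eq_prod ℝ ℝ,
    lintegral_prod _ hmeas.aemeasurable]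
  refine lintegral_congr fun t₁ => ?_
  rw [Measure.prod_apply (measurable_prodMk_left hm)]
  refine lintegral_congr fun t₂ => ?_
  by_cases h1 : (p, t₁) ∈ E
  · by_cases h2 : (p + v t₁ - v t₂, t₂) ∈ E
    · simp [pathSet, outDegree, h1, h2]
    · simp [pathSet, h1, h2]
  · simp [pathSet, h1]

theorem lintegral_volume_pathSet (hE : MeasurableSet E) (hv : Measurable v) :
    ∫⁻ p, volume (pathSet E v p) = ∫⁻ p, ∫⁻ t, E.indicator (fun _ => (1 : ENNReal)) (p, t) *
      (outDegree E p * inDegree E v (p + v t)) := by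
  have he : Measurable (E.indicator fun _ => (1 : ENNReal)) := measurable_const.indicator hE
  have hd := measurable_outDegree hE
  simp_rw [volume_pathSet hE hv]
  rw [lintegral_lintegral_swap]
  · have hshift : ∀ τ : ℝ × ℝ, ∫⁻ p, E.indicator (fun _ => (1 : ENNReal)) (p, τ.1) *
        (E.indicator (fun _ => (1 : ENNReal)) (p + v τ.1 - v τ.2, τ.2) *
          outDegree E (p + v τ.1 - v τ.2))
        = ∫⁻ p, E.indicator (fun _ => (1 : ENNReal)) (p + v τ.2 - v τ.1, τ.1) *
        (E.indicator (fun _ => (1 : ENNReal)) (p, τ.2) * outDegree E p) := by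
      intro τ
      have h₂ : (volume : Measure (ℝ × ℝ)).IsAddHaarMeasure :=
        Measure.prod.instIsAddHaarMeasure volume volume
      rw [← lintegral_add_right_eq_self _ (v τ.2 - v τ.1)]
      refine lintegral_congr fun p => ?_
      have e1 : p + (v τ.2 - v τ.1) + v τ.1 - v τ.2 = p := by abel
      have e2 : p + (v τ.2 - v τ.1) = p + v τ.2 - v τ.1 := by abel
      rw [e1, e2]
    simp_rw [hshift]
    rw [lintegral_lintegral_swap (by fun_prop)]
    refine lintegral_congr fun p => ?_
    rw [Measure.volume_eq_prod, lintegral_prod_symm _ (by fun_prop)]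
    refine lintegral_congr fun t => ?_
    simp only
    rw [lintegral_mul_const _ (by fun_prop), lintegral_indicator_inDegree hE hv]
    ring
  · fun_prop

/-- If few paths with three edges start at any given vertex, there are few edges. -/
theorem volume_le_of_pathSet_le (hE : MeasurableSet E) (hv : Measurable v) {V : Set (ℝ × ℝ)}
    (hV : MeasurableSet V) (hEV : ∀ x ∈ E, x.1 ∈ V ∧ x.1 + v x.2 ∈ V) {C σ : ℝ} (hC : 0 ≤ C)
    (hσ : 0 < σ) (hpath : ∀ p, volume (pathSet E v p) ≤ ENNReal.ofReal (C * σ ^ 3)) :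
    volume E ≤ ENNReal.ofReal ((2 + C) * σ) * volume V := by
  have he : Measurable (E.indicator fun _ => (1 : ENNReal)) := measurable_const.indicator hE
  have hf := measurable_outDegree hE
  have hg := measurable_inDegree hE hv
  set θ := ENNReal.ofReal σ with hθ
  have hθ0 : θ ≠ 0 := by simpa [hθ] using hσ
  have hθt : θ ≠ ⊤ := ENNReal.ofReal_ne_top
  have hsmallf : MeasurableSet {p | outDegree E p < θ} := measurableSet_lt hf measurable_const
  have hsmallg : MeasurableSet {q | inDegree E v q < θ} := measurableSet_lt hg measurable_const
  set F := {p | outDegree E p < θ}.indicator fun _ => (1 : ENNReal) with hF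
  set G := {q | inDegree E v q < θ}.indicator fun _ => (1 : ENNReal) with hG
  have hFm : Measurable F := measurable_const.indicator hsmallf
  have hGm : Measurable G := measurable_const.indicator hsmallg
  set e := E.indicator fun _ => (1 : ENNReal) with hedef
  have hvol : volume E = ∫⁻ p, ∫⁻ t, e (p, t) := by
    rw [Measure.volume_eq_prod, Measure.prod_apply hE]
    exact lintegral_congr fun p => (lintegral_indicator_outDegree hE p).symm
  have hpt : ∀ p t, e (p, t) ≤ e (p, t) * F p + e (p, t) * G (p + v t)
      + (θ * θ)⁻¹ * (e (p, t) * (outDegree E p * inDegree E v (p + v t))) := by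
    intro p t
    by_cases h1 : outDegree E p < θ
    · have : F p = 1 := by simp [hF, h1]
      rw [this, mul_one, add_assoc]
      exact le_self_add
    by_cases h2 : inDegree E v (p + v t) < θ
    · have : G (p + v t) = 1 := by simp [hG, h2]
      rw [this, mul_one]
      exact le_add_right le_add_self
    · push Not at h1 h2
      refine le_add_left ?_
      rw [mul_left_comm]
      refine le_mul_of_one_le_right' ?_
      rw [← ENNReal.inv_mul_cancel (a := θ * θ) (by simp [hθ0])
        (ENNReal.mul_ne_top hθt hθt)]
      gcongr
  have h1 : ∫⁻ p, ∫⁻ t, e (p, t) * F p ≤ θ * volume V := by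
    rw [← lintegral_indicator_const hV]
    refine lintegral_mono fun p => ?_
    rw [lintegral_mul_const _ (by fun_prop), lintegral_indicator_outDegree hE]
    by_cases hp : p ∈ V
    · by_cases hlt : outDegree E p < θ
      · simpa [hF, hlt, hp] using hlt.le
      · simp [hF, hlt]
    · have : outDegree E p = 0 := by
        have : {t | (p, t) ∈ E} = ∅ := by
          ext t; simp only [mem_ofPred_eq, mem_empty_iff_false, iff_false]
          exact fun h => hp (hEV _ h).1
        simp [outDegree, this]
      simp [this]
  have h2 : ∫⁻ p, ∫⁻ t, e (p, t) * G (p + v t) ≤ θ * volume V := by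
    have h₂ : (volume : Measure (ℝ × ℝ)).IsAddHaarMeasure :=
      Measure.prod.instIsAddHaarMeasure volume volume
    rw [lintegral_lintegral_swap (by fun_prop)]
    have hshift : ∀ t, ∫⁻ p, e (p, t) * G (p + v t) = ∫⁻ q, e (q - v t, t) * G q := by
      intro t
      rw [← lintegral_sub_right_eq_self _ (v t)]
      refine lintegral_congr fun p => ?_
      rw [sub_add_cancel]
    simp_rw [hshift]
    rw [lintegral_lintegral_swap (by fun_prop), ← lintegral_indicator_const hV]
    refine lintegral_mono fun q => ?_
    rw [lintegral_mul_const _ (by fun_prop), lintegral_indicator_inDegree hE hv]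
    by_cases hq : q ∈ V
    · by_cases hlt : inDegree E v q < θ
      · simpa [hG, hlt, hq] using hlt.le
      · simp [hG, hlt]
    · have : inDegree E v q = 0 := by
        have : {t | (q - v t, t) ∈ E} = ∅ := by
          ext t; simp only [mem_ofPred_eq, mem_empty_iff_false, iff_false]
          intro h
          have := (hEV _ h).2
          rw [sub_add_cancel] at this
          exact hq this
        simp [inDegree, this]
      simp [this]
  have h3 : ∫⁻ p, volume (pathSet E v p) ≤ ENNReal.ofReal (C * σ ^ 3) * volume V := by
    rw [← lintegral_indicator_const hV]
    refine lintegral_mono fun p => ?_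
    by_cases hp : p ∈ V
    · simpa [hp] using hpath p
    · have : pathSet E v p = ∅ := by
        ext s; simp only [mem_empty_iff_false, iff_false]
        exact fun h => hp (hEV _ h.1).1
      simp [this]
  calc volume E = ∫⁻ p, ∫⁻ t, e (p, t) := hvol
    _ ≤ ∫⁻ p, ∫⁻ t, (e (p, t) * F p + e (p, t) * G (p + v t)
      + (θ * θ)⁻¹ * (e (p, t) * (outDegree E p * inDegree E v (p + v t)))) :=
        lintegral_mono fun p => lintegral_mono fun t => hpt p t
    _ = (∫⁻ p, ∫⁻ t, e (p, t) * F p) + (∫⁻ p, ∫⁻ t, e (p, t) * G (p + v t))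
      + (θ * θ)⁻¹ * ∫⁻ p, volume (pathSet E v p) := by
        rw [lintegral_volume_pathSet hE hv, ← lintegral_const_mul _ (by fun_prop),
          ← lintegral_add_left (by fun_prop), ← lintegral_add_left (by fun_prop)]
        refine lintegral_congr fun p => ?_
        rw [lintegral_add_left (by fun_prop), lintegral_add_left (by fun_prop),
          lintegral_const_mul _ (by fun_prop)]
    _ ≤ θ * volume V + θ * volume V
      + (θ * θ)⁻¹ * (ENNReal.ofReal (C * σ ^ 3) * volume V) := by gcongr
    _ = ENNReal.ofReal ((2 + C) * σ) * volume V := by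
        rw [hθ, ← ENNReal.ofReal_mul hσ.le, ← ENNReal.ofReal_inv_of_pos (by positivity),
          ← mul_assoc, ← add_mul, ← add_mul, ← ENNReal.ofReal_mul (by positivity),
          ← ENNReal.ofReal_add hσ.le hσ.le, ← ENNReal.ofReal_add (by positivity) (by positivity)]
        congr 2
        field_simp
        ring

end Paths

theorem abs_log_le_of_abs_one_add_le {x ρ : ℝ} (h : |1 + x| ≤ ρ) (hρ : ρ ≤ 1 / 2) :
    x ≠ 0 ∧ |Real.log x| ≤ 2 * ρ := by
  obtain ⟨h1, h2⟩ := abs_le.1 h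
  have hx : 1 / 2 ≤ -x := by linarith
  have hx0 : 0 < -x := by linarith
  refine ⟨by linarith, ?_⟩
  rw [← Real.log_neg_eq_log, abs_le]
  have h3 := Real.one_sub_inv_le_log_of_pos hx0
  have h4 := Real.log_le_sub_one_of_pos hx0
  refine ⟨?_, by linarith⟩
  have h5 : (-x)⁻¹ ≤ 1 + 2 * ρ := by
    rw [inv_le_iff_one_le_mul₀' hx0]
    nlinarith
  linarith

theorem abs_log_chain_le {α₀ α₂ β₁ β₃ s₁ s₂ s₃ c₁ c₂ c₃ r ρ A S₀ C₀ S₁ C₁ : ℝ}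
    (hA : 0 < A) (hS₀ : 0 < S₀) (hC₀ : 0 < C₀)
    (h₀ : |α₀ * s₁ + β₁ * c₁| ≤ r) (h₁ : |α₂ * s₂ + β₁ * c₂| ≤ r) (h₂ : |α₂ * s₃ + β₃ * c₃| ≤ r)
    (hs₁ : S₀ ≤ |s₁| ∧ |s₁| ≤ S₁) (hs₂ : S₀ ≤ |s₂| ∧ |s₂| ≤ S₁) (hs₃ : S₀ ≤ |s₃| ∧ |s₃| ≤ S₁)
    (hc₁ : C₀ ≤ |c₁| ∧ |c₁| ≤ C₁) (hc₂ : C₀ ≤ |c₂| ∧ |c₂| ≤ C₁) (hc₃ : C₀ ≤ |c₃| ∧ |c₃| ≤ C₁)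
    (hα : A⁻¹ ≤ |α₀|) (hρ : 3 * (r * S₁ * C₁) * A ≤ ρ * (S₀ * C₀ * S₀)) (hρ' : ρ ≤ 1 / 2) :
    |Real.log s₁ - Real.log c₁ - (Real.log s₂ - Real.log c₂) + (Real.log s₃ - Real.log c₃)
      - Real.log (β₃ / α₀)| ≤ 2 * ρ := by
  have ne : ∀ {x m : ℝ}, 0 < m → m ≤ |x| → x ≠ 0 := fun hm h => abs_pos.1 (hm.trans_le h)
  have s1 := ne hS₀ hs₁.1
  have s2 := ne hS₀ hs₂.1
  have s3 := ne hS₀ hs₃.1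
  have c1 := ne hC₀ hc₁.1
  have c2 := ne hC₀ hc₂.1
  have c3 := ne hC₀ hc₃.1
  have a0 := ne (inv_pos.2 hA) hα
  have hr : 0 ≤ r := (abs_nonneg _).trans h₀
  have hS : 0 ≤ S₁ := (abs_nonneg _).trans hs₁.2
  have hC : 0 ≤ C₁ := (abs_nonneg _).trans hc₁.2
  have key : |α₀ * s₁ * c₂ * s₃ + β₃ * c₁ * s₂ * c₃| ≤ 3 * (r * S₁ * C₁) := by
    have e : α₀ * s₁ * c₂ * s₃ + β₃ * c₁ * s₂ * c₃ = (α₀ * s₁ + β₁ * c₁) * s₃ * c₂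
        + -((α₂ * s₂ + β₁ * c₂) * s₃ * c₁) + (α₂ * s₃ + β₃ * c₃) * s₂ * c₁ := by ring
    have t : ∀ {x y z : ℝ}, |x| ≤ r → |y| ≤ S₁ → |z| ≤ C₁ → |x * y * z| ≤ r * S₁ * C₁ := by
      intro x y z hx hy hz
      rw [abs_mul, abs_mul]
      gcongr
    rw [e]
    refine (abs_add_three _ _ _).trans ?_
    rw [abs_neg]
    linarith [t h₀ hs₃.2 hc₂.2, t h₁ hs₃.2 hc₁.2, t h₂ hs₂.2 hc₁.2]
  have hden : A⁻¹ * (S₀ * C₀ * S₀) ≤ |α₀ * s₁ * c₂ * s₃| := by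
    have e : α₀ * s₁ * c₂ * s₃ = α₀ * (s₁ * c₂ * s₃) := by ring
    rw [e, abs_mul, abs_mul, abs_mul]
    exact mul_le_mul hα (mul_le_mul (mul_le_mul hs₁.1 hc₂.1 hC₀.le (abs_nonneg _)) hs₃.1 hS₀.le
      (by positivity)) (by positivity) (abs_nonneg _)
  set x := β₃ / α₀ * ((c₁ / s₁) * (s₂ / c₂) * (c₃ / s₃)) with hx
  have hρ0 : 0 ≤ ρ := by
    by_contra hneg
    have h1 : 0 ≤ 3 * (r * S₁ * C₁) * A := by positivity
    have h2 : 0 < S₀ * C₀ * S₀ := by positivity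
    nlinarith
  have hx1 : |1 + x| ≤ ρ := by
    have e : 1 + x = (α₀ * s₁ * c₂ * s₃ + β₃ * c₁ * s₂ * c₃) / (α₀ * s₁ * c₂ * s₃) := by
      rw [hx]; field_simp
    have hpos : 0 < |α₀ * s₁ * c₂ * s₃| := lt_of_lt_of_le (by positivity) hden
    rw [e, abs_div, div_le_iff₀ hpos]
    refine key.trans ?_
    calc 3 * (r * S₁ * C₁) = A⁻¹ * (3 * (r * S₁ * C₁) * A) := by field_simp
      _ ≤ A⁻¹ * (ρ * (S₀ * C₀ * S₀)) := by gcongr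
      _ = ρ * (A⁻¹ * (S₀ * C₀ * S₀)) := by ring
      _ ≤ _ := by gcongr
  obtain ⟨hx0, hlog⟩ := abs_log_le_of_abs_one_add_le hx1 hρ'
  have hβ : β₃ / α₀ ≠ 0 := fun h => hx0 (by rw [hx, h, zero_mul])
  have hexp : Real.log x = Real.log (β₃ / α₀) + (Real.log c₁ - Real.log s₁
      + (Real.log s₂ - Real.log c₂) + (Real.log c₃ - Real.log s₃)) := by
    rw [hx, Real.log_mul hβ (by positivity), Real.log_mul (by positivity) (by positivity),
      Real.log_mul (by positivity) (by positivity), Real.log_div c1 s1, Real.log_div s2 c2,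
      Real.log_div c3 s3]
  rw [← abs_neg]
  refine le_trans (le_of_eq ?_) hlog
  rw [hexp]
  congr 1
  ring

theorem abs_altSum_log_sub_le {E : Set ((ℝ × ℝ) × ℝ)} {v : ℝ → ℝ × ℝ} {f h : ℝ × ℝ → ℝ}
    {S C : ℝ → ℝ} {r ρ A S₀ C₀ S₁ C₁ : ℝ} (hA : 0 < A) (hS₀ : 0 < S₀) (hC₀ : 0 < C₀)
    (hE : ∀ x ∈ E, |f x.1 * S x.2 + h (x.1 + v x.2) * C x.2| ≤ r)
    (hS : ∀ x ∈ E, S₀ ≤ |S x.2| ∧ |S x.2| ≤ S₁) (hC : ∀ x ∈ E, C₀ ≤ |C x.2| ∧ |C x.2| ≤ C₁)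
    {p : ℝ × ℝ} (hf : A⁻¹ ≤ |f p|) (hρ : 3 * (r * S₁ * C₁) * A ≤ ρ * (S₀ * C₀ * S₀))
    (hρ' : ρ ≤ 1 / 2) {s : ℝ × ℝ × ℝ} (hs : s ∈ pathSet E v p) :
    |altSum (fun t => Real.log (S t) - Real.log (C t)) s
      - Real.log (h (p + v s.1 - v s.2.1 + v s.2.2) / f p)| ≤ 2 * ρ := by
  obtain ⟨e1, e2, e3⟩ := hs
  have h1 := hE _ e1
  have h2 := hE _ e2
  have h3 := hE _ e3
  simp only [sub_add_cancel] at h1 h2 h3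
  exact abs_log_chain_le hA hS₀ hC₀ h1 h2 h3 (hS _ e1) (hS _ e2) (hS _ e3) (hC _ e1) (hC _ e2)
    (hC _ e3) hf hρ hρ'

/-- The parameters `s ∈ [1, 2]` for which `δ s` lies in the `k`-th quadrant, at distance at least
`δ σ` from its ends. -/
noncomputable def quadrantPart (δ σ : ℝ) (k : ℕ) : Set ℝ :=
  Icc (max 1 (k * (Real.pi / 2) / δ + σ)) (min 2 ((k + 1) * (Real.pi / 2) / δ - σ))

section Quadrant

variable {δ σ : ℝ} {k : ℕ}

theorem mem_quadrantPart (hδ : 0 < δ) {s : ℝ} :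
    s ∈ quadrantPart δ σ k ↔ s ∈ Icc (1 : ℝ) 2 ∧ k * (Real.pi / 2) + δ * σ ≤ δ * s ∧
      δ * s ≤ (k + 1) * (Real.pi / 2) - δ * σ := by
  have h1 : k * (Real.pi / 2) / δ + σ ≤ s ↔ k * (Real.pi / 2) + δ * σ ≤ δ * s := by
    rw [← mul_le_mul_iff_right₀ hδ, mul_add, mul_div_cancel₀ _ hδ.ne']
  have h2 : s ≤ (k + 1) * (Real.pi / 2) / δ - σ ↔ δ * s ≤ (k + 1) * (Real.pi / 2) - δ * σ := by
    rw [← mul_le_mul_iff_right₀ hδ, mul_sub, mul_div_cancel₀ _ hδ.ne']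
  simp only [quadrantPart, mem_Icc, max_le_iff, le_min_iff, h1, h2]
  tauto

theorem le_abs_sin_mul_cos (hδ : 0 < δ) (hσ : 0 < σ) {s : ℝ} (hs : s ∈ quadrantPart δ σ k) :
    δ * σ / 2 ≤ |Real.sin (δ * s) * Real.cos (δ * s)| := by
  obtain ⟨-, h1, h2⟩ := (mem_quadrantPart hδ).1 hs
  have hδσ : 0 < δ * σ := mul_pos hδ hσ
  set u := δ * s - k * (Real.pi / 2) with hu
  have hpi := Real.pi_pos
  have hsin : |Real.sin (2 * (δ * s))| = |Real.sin (2 * u)| := by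
    have : 2 * (δ * s) = 2 * u + k * Real.pi := by rw [hu]; ring
    rw [this, Real.sin_add_nat_mul_pi, abs_mul, abs_neg_one_pow, one_mul]
  have hu1 : δ * σ ≤ u := by linarith
  have hu2 : u ≤ Real.pi / 2 - δ * σ := by linarith
  have hbound : δ * σ ≤ |Real.sin (2 * u)| := by
    have aux : ∀ x : ℝ, 2 * (δ * σ) ≤ x → x ≤ Real.pi / 2 → δ * σ ≤ |Real.sin x| := by
      intro x hx1 hx2
      have hx0 : 0 ≤ x := by linarith
      have h := Real.mul_abs_le_abs_sin (x := x) (by rwa [abs_of_nonneg hx0])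
      rw [abs_of_nonneg hx0] at h
      refine le_trans ?_ h
      rw [div_mul_eq_mul_div, le_div_iff₀ hpi]
      nlinarith [Real.pi_le_four]
    rcases le_total (2 * u) (Real.pi / 2) with h | h
    · exact aux _ (by linarith) h
    · rw [← Real.sin_pi_sub]
      exact aux _ (by linarith) (by linarith)
  rw [← hsin, Real.sin_two_mul, mul_assoc, abs_mul, abs_two] at hbound
  linarith

theorem abs_sin_bounds (hδ : 0 < δ) (hσ : 0 < σ) {s : ℝ} (hs : s ∈ quadrantPart δ σ k) :
    δ * σ / 2 ≤ |Real.sin (δ * s)| ∧ |Real.sin (δ * s)| ≤ 2 * δ := by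
  have h := le_abs_sin_mul_cos hδ hσ hs
  rw [abs_mul] at h
  obtain ⟨⟨h1, h2⟩, -⟩ := (mem_quadrantPart hδ).1 hs
  constructor
  · exact h.trans (mul_le_of_le_one_right (abs_nonneg _) (Real.abs_cos_le_one _))
  · refine Real.abs_sin_le_abs.trans ?_
    rw [abs_of_nonneg (by positivity)]
    nlinarith

theorem abs_cos_bounds (hδ : 0 < δ) (hσ : 0 < σ) {s : ℝ} (hs : s ∈ quadrantPart δ σ k) :
    σ / 4 ≤ |Real.cos (δ * s)| ∧ |Real.cos (δ * s)| ≤ 1 := by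
  have h := le_abs_sin_mul_cos hδ hσ hs
  rw [abs_mul] at h
  refine ⟨?_, Real.abs_cos_le_one _⟩
  have h1 := (abs_sin_bounds hδ hσ hs).2
  have h2 : δ * σ / 2 ≤ 2 * δ * |Real.cos (δ * s)| := h.trans (by gcongr)
  have h3 : δ * (σ / 2) ≤ δ * (2 * |Real.cos (δ * s)|) := by linarith
  linarith [le_of_mul_le_mul_left h3 hδ]

theorem boundedC11On_cos (hδ : 0 < δ) :
    BoundedC11On (fun s => Real.cos (δ * s) / δ ^ 2) (fun s => -Real.sin (δ * s) / δ)
      (quadrantPart δ σ k) 2 where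
  hasDerivAt s _ := by
    have h : HasDerivAt (fun s => δ * s) δ s := by simpa using (hasDerivAt_id s).const_mul δ
    refine (h.cos.div_const (δ ^ 2)).congr_deriv ?_
    field_simp
  abs_le s hs := by
    obtain ⟨⟨h1, h2⟩, -⟩ := (mem_quadrantPart hδ).1 hs
    rw [abs_div, abs_neg, abs_of_pos hδ, div_le_iff₀ hδ]
    refine Real.abs_sin_le_abs.trans ?_
    rw [abs_of_nonneg (by positivity)]
    nlinarith
  lipschitz s _ s' _ := by
    have e : -Real.sin (δ * s') / δ - -Real.sin (δ * s) / δ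
        = -((Real.sin (δ * s') - Real.sin (δ * s)) / δ) := by ring
    rw [e, abs_neg, abs_div, abs_of_pos hδ, div_le_iff₀ hδ]
    refine (Real.abs_sin_sub_sin_le _ _).trans ?_
    rw [← mul_sub, abs_mul, abs_of_pos hδ]
    nlinarith [abs_nonneg (s' - s)]

theorem boundedC11On_sin (hδ : 0 < δ) :
    BoundedC11On (fun s => Real.sin (δ * s) / δ) (fun s => Real.cos (δ * s))
      (quadrantPart δ σ k) (1 + δ) where
  hasDerivAt s _ := by
    have h : HasDerivAt (fun s => δ * s) δ s := by simpa using (hasDerivAt_id s).const_mul δ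
    refine (h.sin.div_const δ).congr_deriv ?_
    field_simp
  abs_le s _ := (Real.abs_cos_le_one _).trans (by linarith)
  lipschitz s _ s' _ := by
    refine (Real.abs_cos_sub_cos_le _ _).trans ?_
    rw [← mul_sub, abs_mul, abs_of_pos hδ]
    nlinarith [abs_nonneg (s' - s)]

theorem boundedC11On_logTan (hδ : 0 < δ) (hσ : 0 < σ) (hσ1 : σ ≤ 1) :
    BoundedC11On (fun s => Real.log (Real.sin (δ * s)) - Real.log (Real.cos (δ * s)))
      (fun s => δ / (Real.sin (δ * s) * Real.cos (δ * s)))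
      (quadrantPart δ σ k) (4 / σ ^ 2) where
  hasDerivAt s hs := by
    have hpos : 0 < |Real.sin (δ * s) * Real.cos (δ * s)| :=
      lt_of_lt_of_le (by positivity) (le_abs_sin_mul_cos hδ hσ hs)
    have hs0 := left_ne_zero_of_mul (abs_pos.1 hpos)
    have hc0 := right_ne_zero_of_mul (abs_pos.1 hpos)
    have h : HasDerivAt (fun s => δ * s) δ s := by simpa using (hasDerivAt_id s).const_mul δ
    refine ((h.sin.log hs0).sub (h.cos.log hc0)).congr_deriv ?_
    field_simp
    rw [sub_neg_eq_add, add_comm, Real.sin_sq_add_cos_sq]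
  abs_le s hs := by
    have hb := le_abs_sin_mul_cos hδ hσ hs
    have hpos : 0 < δ * σ / 2 := by positivity
    rw [abs_div, abs_of_pos hδ]
    calc δ / |Real.sin (δ * s) * Real.cos (δ * s)| ≤ δ / (δ * σ / 2) := by gcongr
      _ = 2 / σ := by field_simp
      _ ≤ 4 / σ ^ 2 := by
        rw [div_le_div_iff₀ hσ (by positivity)]
        nlinarith
  lipschitz s hs s' hs' := by
    have hb := le_abs_sin_mul_cos hδ hσ hs
    have hb' := le_abs_sin_mul_cos hδ hσ hs'
    have hpos : 0 < δ * σ / 2 := by positivity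
    set x := Real.sin (δ * s) * Real.cos (δ * s) with hx
    set y := Real.sin (δ * s') * Real.cos (δ * s') with hy
    have hx0 : x ≠ 0 := abs_pos.1 (hpos.trans_le hb)
    have hy0 : y ≠ 0 := abs_pos.1 (hpos.trans_le hb')
    have hxy : |x - y| ≤ δ * |s' - s| := by
      have e : x - y = (Real.sin (2 * (δ * s)) - Real.sin (2 * (δ * s'))) / 2 := by
        rw [Real.sin_two_mul, Real.sin_two_mul]; ring
      rw [e, abs_div, abs_two, div_le_iff₀ two_pos]
      refine (Real.abs_sin_sub_sin_le _ _).trans (le_of_eq ?_)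
      rw [← mul_sub, ← mul_sub, abs_mul, abs_mul, abs_two, abs_of_pos hδ, abs_sub_comm]
      ring
    have e : δ / y - δ / x = δ * (x - y) / (y * x) := by field_simp
    rw [e, abs_div, abs_mul, abs_mul, abs_of_pos hδ]
    calc δ * |x - y| / (|y| * |x|) ≤ δ * (δ * |s' - s|) / (δ * σ / 2 * (δ * σ / 2)) := by gcongr
      _ = 4 / σ ^ 2 * |s' - s| := by field_simp; ring

theorem le_abs_det3_quadrantPart (hδ : 0 < δ) (hσ : 0 < σ) {s : ℝ × ℝ × ℝ}
    (hs : s ∈ quadrantPart δ σ k ×ˢ (quadrantPart δ σ k ×ˢ quadrantPart δ σ k)) :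
    1 / (2 * Real.pi ^ 3) * absVandermonde s
      ≤ |det3 (triple (fun s => -Real.sin (δ * s) / δ) s) (triple (fun s => Real.cos (δ * s)) s)
        (triple (fun s => δ / (Real.sin (δ * s) * Real.cos (δ * s))) s)| := by
  have hpi := Real.pi_pos
  have hδσ : 0 < δ * σ := mul_pos hδ hσ
  have hk : 0 ≤ k * (Real.pi / 2) := by positivity
  have hu : ∀ x ∈ quadrantPart δ σ k, δ * x - k * (Real.pi / 2) ∈ Ioo 0 (Real.pi / 2) ∧
      δ * x - k * (Real.pi / 2) ≤ 2 * δ := by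
    intro x hx
    obtain ⟨⟨h1, h2⟩, h3, h4⟩ := (mem_quadrantPart hδ).1 hx
    exact ⟨⟨by linarith, by linarith⟩, by nlinarith⟩
  obtain ⟨h1, h2, h3⟩ := hs
  set u : ℝ × ℝ × ℝ := (δ * s.1 - k * (Real.pi / 2), δ * s.2.1 - k * (Real.pi / 2),
    δ * s.2.2 - k * (Real.pi / 2)) with hudef
  have hlow := le_abs_trigDet (u := u) (hu _ h1).1 (hu _ h2).1 (hu _ h3).1 (hu _ h1).2
    (hu _ h2).2 (hu _ h3).2
  rw [← abs_trigDet_add_nat_mul u k] at hlow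
  simp only [hudef, sub_add_cancel] at hlow
  have hdet : trigDet (δ * s.1, δ * s.2.1, δ * s.2.2)
      = det3 (triple (fun s => -Real.sin (δ * s) / δ) s) (triple (fun s => Real.cos (δ * s)) s)
        (triple (fun s => δ / (Real.sin (δ * s) * Real.cos (δ * s))) s) := by
    simp only [trigDet, det3, triple]
    field_simp
  have hvan : absVandermonde u = δ ^ 3 * absVandermonde s := by
    have e : ∀ x y : ℝ, |δ * x - k * (Real.pi / 2) - (δ * y - k * (Real.pi / 2))|
        = δ * |x - y| := fun x y => by
      rw [sub_sub_sub_cancel_right, ← mul_sub, abs_mul, abs_of_pos hδ]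
    simp only [absVandermonde, hudef, e]
    ring
  rw [← hudef, hvan, hdet] at hlow
  have hδ3 : 0 < 8 * δ ^ 3 := by positivity
  refine le_of_mul_le_mul_left ?_ hδ3
  calc 8 * δ ^ 3 * (1 / (2 * Real.pi ^ 3) * absVandermonde s)
      = (2 / Real.pi) ^ 3 / 2 * (δ ^ 3 * absVandermonde s) := by field_simp; ring
    _ ≤ _ := hlow
    _ = _ := by ring

theorem volume_trig_sublevel_le {D R : ℝ} (hδ : 0 < δ) (hδD : δ ≤ D) (hσ : 0 < σ) (hσ1 : σ ≤ 1)
    (hR : 0 ≤ R) {φ : ℝ × ℝ → ℝ} (hφ : Measurable φ) {T : Set (ℝ × ℝ × ℝ)} (hT : MeasurableSet T)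
    (hTJ : T ⊆ quadrantPart δ σ k ×ˢ (quadrantPart δ σ k ×ˢ quadrantPart δ σ k))
    (hsub : ∀ s ∈ T, |altSum (fun s => Real.log (Real.sin (δ * s)) - Real.log (Real.cos (δ * s))) s
      - φ (altSum (fun s => Real.cos (δ * s) / δ ^ 2) s, altSum (fun s => Real.sin (δ * s) / δ) s)|
        ≤ R * σ ^ 32) :
    volume T ≤ ENNReal.ofReal ((6 + 21888 * (2 + D) ^ 4 * Real.pi ^ 6 * R) * σ ^ 3) := by
  have hpi : (1 : ℝ) ≤ Real.pi := by linarith [Real.pi_gt_three]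
  have hpi3 : 1 ≤ 2 * Real.pi ^ 3 := by linarith [one_le_pow₀ hpi (n := 3)]
  have hmain := volume_altSum_sublevel_le (H := 2 + D) (M := 4 / σ ^ 2)
    (c := 1 / (2 * Real.pi ^ 3)) (η := σ ^ 3) (r := R * σ ^ 32)
    ((boundedC11On_cos hδ).mono (by linarith)) ((boundedC11On_sin hδ).mono (by linarith))
    (boundedC11On_logTan hδ hσ hσ1) (le_max_left _ _) (min_le_left _ _) (by linarith)
    (by rw [le_div_iff₀ (by positivity)]; nlinarith) (by positivity)
    (by rw [div_le_one (by positivity)]; exact hpi3) (by positivity) (pow_le_one₀ hσ.le hσ1)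
    (by positivity) (fun s hs => le_abs_det3_quadrantPart hδ hσ hs) hφ hT hTJ hsub
  refine hmain.trans (ENNReal.ofReal_le_ofReal ?_)
  have e : 1368 * (2 + D) ^ 4 * (4 / σ ^ 2) * (R * σ ^ 32)
      / ((1 / (2 * Real.pi ^ 3)) ^ 2 * (σ ^ 3) ^ 6)
      = 21888 * (2 + D) ^ 4 * Real.pi ^ 6 * R * σ ^ 12 := by
    field_simp; ring
  have h12 : σ ^ 12 ≤ σ ^ 3 := pow_le_pow_of_le_one hσ.le hσ1 (by norm_num)
  have hco : 0 ≤ 21888 * (2 + D) ^ 4 * Real.pi ^ 6 * R := by positivity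
  rw [e]
  nlinarith [mul_le_mul_of_nonneg_left h12 hco]

end Quadrant

theorem volume_shear_preimage {S : Set ((ℝ × ℝ) × ℝ)} (hS : MeasurableSet S) {w : ℝ → ℝ × ℝ}
    (hw : Measurable w) :
    volume {x : (ℝ × ℝ) × ℝ | (x.1 + w x.2, x.2) ∈ S} = volume S := by
  have h₂ : (volume : Measure (ℝ × ℝ)).IsAddHaarMeasure :=
    Measure.prod.instIsAddHaarMeasure volume volume
  have hm : Measurable fun x : (ℝ × ℝ) × ℝ => (x.1 + w x.2, x.2) := by fun_prop
  have hS' : MeasurableSet {x : (ℝ × ℝ) × ℝ | (x.1 + w x.2, x.2) ∈ S} := hm hS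
  rw [Measure.volume_eq_prod, Measure.prod_apply_symm hS', Measure.prod_apply_symm hS]
  refine lintegral_congr fun t => ?_
  exact measure_preimage_add_right volume (w t) ((fun z => (z, t)) ⁻¹' S)

theorem volume_add_mem_null {N : Set (ℝ × ℝ)} (hN : volume N = 0) {w : ℝ → ℝ × ℝ}
    (hw : Measurable w) : volume {x : (ℝ × ℝ) × ℝ | x.1 + w x.2 ∈ N} = 0 := by
  have hm : MeasurableSet (toMeasurable volume N ×ˢ (univ : Set ℝ)) :=
    (measurableSet_toMeasurable _ _).prod MeasurableSet.univ
  refine measure_mono_null (t := {x : (ℝ × ℝ) × ℝ |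
    (x.1 + w x.2, x.2) ∈ toMeasurable volume N ×ˢ (univ : Set ℝ)}) ?_ ?_
  · exact fun x hx => ⟨subset_toMeasurable _ _ hx, mem_univ _⟩
  · rw [volume_shear_preimage hm hw, Measure.volume_eq_prod, Measure.prod_prod,
      measure_toMeasurable, hN, zero_mul]

theorem volume_scale_snd {S : Set ((ℝ × ℝ) × ℝ)} (hS : MeasurableSet S) {δ : ℝ} (hδ : 0 < δ) :
    volume S = ENNReal.ofReal δ * volume {x : (ℝ × ℝ) × ℝ | (x.1, δ * x.2) ∈ S} := by
  have hm : Measurable fun x : (ℝ × ℝ) × ℝ => (x.1, δ * x.2) := by fun_prop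
  have hS' : MeasurableSet {x : (ℝ × ℝ) × ℝ | (x.1, δ * x.2) ∈ S} := hm hS
  rw [Measure.volume_eq_prod, Measure.prod_apply hS', Measure.prod_apply hS,
    ← lintegral_const_mul _ (measurable_measure_prodMk_left hS')]
  refine lintegral_congr fun z => ?_
  have e : Prod.mk z ⁻¹' {x : (ℝ × ℝ) × ℝ | (x.1, δ * x.2) ∈ S}
      = (fun t => δ * t) ⁻¹' (Prod.mk z ⁻¹' S) := rfl
  rw [e, Real.volume_preimage_mul_left hδ.ne', ← mul_assoc, ← ENNReal.ofReal_mul hδ.le,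
    abs_of_pos (inv_pos.2 hδ), mul_inv_cancel₀ hδ.ne', ENNReal.ofReal_one, one_mul]

/-- The constant in the bound for the measure of the edges in a single quadrant. -/
noncomputable def quadrantConst (D R : ℝ) : ℝ :=
  6 + 21888 * (2 + D) ^ 4 * Real.pi ^ 6 * (2 * R) + 2 * R

theorem quadrantConst_nonneg {D R : ℝ} (hR : 0 ≤ R) : 0 ≤ quadrantConst D R := by
  unfold quadrantConst; positivity

section Edges

variable {δ D σ R : ℝ} {k : ℕ}

theorem volume_edges_le (hδ : 0 < δ) (hδD : δ ≤ D) (hσ : 0 < σ) (hσ1 : σ ≤ 1) (hR : 0 ≤ R)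
    {E : Set ((ℝ × ℝ) × ℝ)} (hE : MeasurableSet E) (hEJ : ∀ x ∈ E, x.2 ∈ quadrantPart δ σ k)
    {v : ℝ → ℝ × ℝ} (hv : Measurable v) {V : Set (ℝ × ℝ)} (hV : MeasurableSet V)
    (hEV : ∀ x ∈ E, x.1 ∈ V ∧ x.1 + v x.2 ∈ V)
    (hphase : R * σ ^ 32 ≤ 1 / 2 → ∀ p, ∃ φ : ℝ × ℝ → ℝ, Measurable φ ∧ ∀ s ∈ pathSet E v p,
      |altSum (fun s => Real.log (Real.sin (δ * s)) - Real.log (Real.cos (δ * s))) s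
      - φ (altSum (fun s => Real.cos (δ * s) / δ ^ 2) s, altSum (fun s => Real.sin (δ * s) / δ) s)|
        ≤ 2 * (R * σ ^ 32)) :
    volume E ≤ ENNReal.ofReal ((2 + quadrantConst D R) * σ) * volume V := by
  refine volume_le_of_pathSet_le hE hv hV hEV (quadrantConst_nonneg hR) hσ fun p => ?_
  have hD : 0 < D := hδ.trans_le hδD
  have hJ : pathSet E v p ⊆ quadrantPart δ σ k ×ˢ (quadrantPart δ σ k ×ˢ quadrantPart δ σ k) :=
    fun s hs => ⟨hEJ _ hs.1, hEJ _ hs.2.1, hEJ _ hs.2.2⟩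
  have hσ3 : 0 < σ ^ 3 := by positivity
  by_cases hsmall : R * σ ^ 32 ≤ 1 / 2
  · obtain ⟨φ, hφ, hφs⟩ := hphase hsmall p
    refine (volume_trig_sublevel_le hδ hδD hσ hσ1 (R := 2 * R) (by positivity) hφ
      (measurableSet_pathSet hE hv p) hJ (fun s hs => (hφs s hs).trans (by linarith))).trans
      (ENNReal.ofReal_le_ofReal ?_)
    unfold quadrantConst
    refine mul_le_mul_of_nonneg_right ?_ hσ3.le
    linarith
  · push Not at hsmall
    have hJ12 : quadrantPart δ σ k ⊆ Icc 1 2 := fun s hs => ((mem_quadrantPart hδ).1 hs).1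
    have h1 : volume (Icc (1 : ℝ) 2 ×ˢ (Icc (1 : ℝ) 2 ×ˢ Icc (1 : ℝ) 2)) = ENNReal.ofReal 1 := by
      have : volume (Icc (1 : ℝ) 2) = 1 := by rw [Real.volume_Icc]; norm_num
      rw [Measure.volume_eq_prod, Measure.prod_prod, Measure.volume_eq_prod, Measure.prod_prod,
        this]
      simp
    refine (measure_mono (hJ.trans (prod_mono hJ12 (prod_mono hJ12 hJ12)))).trans
      (h1.le.trans (ENNReal.ofReal_le_ofReal ?_))
    have h32 : σ ^ 32 ≤ σ ^ 3 := pow_le_pow_of_le_one hσ.le hσ1 (by norm_num)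
    have h2 : R * σ ^ 32 ≤ R * σ ^ 3 := by gcongr
    calc 1 ≤ 2 * R * σ ^ 3 := by linarith
      _ ≤ quadrantConst D R * σ ^ 3 := by
        unfold quadrantConst
        gcongr
        have : 0 ≤ 21888 * (2 + D) ^ 4 * Real.pi ^ 6 * (2 * R) := by positivity
        linarith

theorem measurableSet_sublevelSet {K : Set ((ℝ × ℝ) × ℝ)} (hK : MeasurableSet K)
    {α β : ℝ × ℝ → ℝ} (hα : Measurable α) (hβ : Measurable β) (r : ℝ) :
    MeasurableSet (sublevelSet K α β r) := by
  have h : Measurable fun p : (ℝ × ℝ) × ℝ => |α (p.1.1 + Real.cos p.2, p.1.2) * Real.sin p.2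
      + β (p.1.1, p.1.2 + Real.sin p.2) * Real.cos p.2| := by fun_prop
  exact hK.inter (measurableSet_le h measurable_const)

/-- The bound in one quadrant when the first coefficient is bounded below. -/
theorem volume_quadrant_le_of_left {A B : ℝ} (hA : 1 ≤ A) (hB : 0 < B) (hδ : 0 < δ) (hδD : δ ≤ D)
    (hσ : 0 < σ) (hσ1 : σ ≤ 1) {K : Set ((ℝ × ℝ) × ℝ)} (hK : MeasurableSet K) {α β : ℝ × ℝ → ℝ}
    (hα : Measurable α) (hβ : Measurable β) (hαA : ∀ z, A⁻¹ ≤ |α z|) {V : Set (ℝ × ℝ)}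
    (hV : MeasurableSet V)
    (hKV : ∀ x ∈ K, x.1 + (Real.cos x.2, 0) ∈ V ∧ x.1 + (0, Real.sin x.2) ∈ V) :
    volume {x : (ℝ × ℝ) × ℝ | x.2 ∈ quadrantPart δ σ k ∧
      (x.1, δ * x.2) ∈ sublevelSet K α β (B * (δ * σ ^ 35))}
      ≤ ENNReal.ofReal ((2 + quadrantConst D (192 * A * B * (1 + D))) * σ) * volume V := by
  have hD : 0 < D := hδ.trans_le hδD
  set S := {x : (ℝ × ℝ) × ℝ | x.2 ∈ quadrantPart δ σ k ∧
      (x.1, δ * x.2) ∈ sublevelSet K α β (B * (δ * σ ^ 35))} with hSdef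
  have hm : Measurable fun x : (ℝ × ℝ) × ℝ => (x.1, δ * x.2) := by fun_prop
  have hS : MeasurableSet S := (measurable_snd measurableSet_Icc).inter
    (hm (measurableSet_sublevelSet hK hα hβ _))
  have hw : Measurable fun s : ℝ => ((-Real.cos (δ * s), 0) : ℝ × ℝ) := by fun_prop
  rw [← volume_shear_preimage hS hw]
  have hE : MeasurableSet {x : (ℝ × ℝ) × ℝ | (x.1 + (-Real.cos (δ * x.2), (0 : ℝ)), x.2) ∈ S} := by
    have hm' : Measurable
      fun x : (ℝ × ℝ) × ℝ => (x.1 + (-Real.cos (δ * x.2), (0 : ℝ)), x.2) := by fun_prop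
    exact hm' hS
  refine volume_edges_le hδ hδD hσ hσ1 (by positivity) hE (fun x hx => hx.1)
    (v := fun s => (-Real.cos (δ * s), Real.sin (δ * s))) (by fun_prop) hV ?_ ?_
  · intro x hx
    have := hKV _ hx.2.1
    convert this using 2
    · ext <;> simp
    · ext <;> simp
  · intro hsmall p
    refine ⟨fun g => Real.log (β (p + (-(δ ^ 2 * g.1), δ * g.2)) / α p), by fun_prop, ?_⟩
    intro s hs
    have key := abs_altSum_log_sub_le (f := α) (h := β) (S := fun s => Real.sin (δ * s))
      (C := fun s => Real.cos (δ * s)) (r := B * (δ * σ ^ 35)) (ρ := 192 * A * B * (1 + D) * σ ^ 32)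
      (S₀ := δ * σ / 2) (S₁ := 2 * δ) (C₀ := σ / 4) (C₁ := 1) (A := A)
      (by linarith) (by positivity) (by positivity)
      (fun x hx => by
        have h := hx.2.2
        simp only [Prod.fst_add, Prod.snd_add, neg_add_cancel_right, add_zero] at h
        convert h using 5
        ext <;> simp)
      (fun x hx => abs_sin_bounds hδ hσ hx.1) (fun x hx => abs_cos_bounds hδ hσ hx.1) (hαA p)
      (by
        have e1 : 3 * (B * (δ * σ ^ 35) * (2 * δ) * 1) * A = δ ^ 2 * σ ^ 35 * (6 * A * B) := by ring
        have e2 : 192 * A * B * (1 + D) * σ ^ 32 * (δ * σ / 2 * (σ / 4) * (δ * σ / 2))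
            = δ ^ 2 * σ ^ 35 * (12 * A * B * (1 + D)) := by ring
        rw [e1, e2]
        have hA0 : 0 < A := by linarith
        have : 6 * A * B ≤ 12 * A * B * (1 + D) := by
          have hAB : 0 < A * B := by positivity
          nlinarith
        gcongr)
      hsmall hs
    convert key using 6
    ext <;> simp [altSum] <;> field_simp <;> ring

/-- The bound in one quadrant when the second coefficient is bounded below. -/
theorem volume_quadrant_le_of_right {A B : ℝ} (hA : 1 ≤ A) (hB : 0 < B) (hδ : 0 < δ) (hδD : δ ≤ D)
    (hσ : 0 < σ) (hσ1 : σ ≤ 1) {K : Set ((ℝ × ℝ) × ℝ)} (hK : MeasurableSet K) {α β : ℝ × ℝ → ℝ}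
    (hα : Measurable α) (hβ : Measurable β) (hβA : ∀ z, A⁻¹ ≤ |β z|) {V : Set (ℝ × ℝ)}
    (hV : MeasurableSet V)
    (hKV : ∀ x ∈ K, x.1 + (Real.cos x.2, 0) ∈ V ∧ x.1 + (0, Real.sin x.2) ∈ V) :
    volume {x : (ℝ × ℝ) × ℝ | x.2 ∈ quadrantPart δ σ k ∧
      (x.1, δ * x.2) ∈ sublevelSet K α β (B * (δ * σ ^ 35))}
      ≤ ENNReal.ofReal ((2 + quadrantConst D (192 * A * B * (1 + D))) * σ) * volume V := by
  have hD : 0 < D := hδ.trans_le hδD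
  set S := {x : (ℝ × ℝ) × ℝ | x.2 ∈ quadrantPart δ σ k ∧
      (x.1, δ * x.2) ∈ sublevelSet K α β (B * (δ * σ ^ 35))} with hSdef
  have hm : Measurable fun x : (ℝ × ℝ) × ℝ => (x.1, δ * x.2) := by fun_prop
  have hS : MeasurableSet S := (measurable_snd measurableSet_Icc).inter
    (hm (measurableSet_sublevelSet hK hα hβ _))
  have hw : Measurable fun s : ℝ => ((0, -Real.sin (δ * s)) : ℝ × ℝ) := by fun_prop
  rw [← volume_shear_preimage hS hw]
  have hE : MeasurableSet {x : (ℝ × ℝ) × ℝ | (x.1 + ((0 : ℝ), -Real.sin (δ * x.2)), x.2) ∈ S} := by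
    have hm' : Measurable
      fun x : (ℝ × ℝ) × ℝ => (x.1 + ((0 : ℝ), -Real.sin (δ * x.2)), x.2) := by fun_prop
    exact hm' hS
  refine volume_edges_le hδ hδD hσ hσ1 (by positivity) hE (fun x hx => hx.1)
    (v := fun s => (Real.cos (δ * s), -Real.sin (δ * s))) (by fun_prop) hV ?_ ?_
  · intro x hx
    have := (hKV _ hx.2.1).symm
    convert this using 2
    · ext <;> simp
    · ext <;> simp
  · intro hsmall p
    refine ⟨fun g => -Real.log (α (p + (δ ^ 2 * g.1, -(δ * g.2))) / β p), by fun_prop, ?_⟩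
    intro s hs
    have key := abs_altSum_log_sub_le (f := β) (h := α) (S := fun s => Real.cos (δ * s))
      (C := fun s => Real.sin (δ * s)) (r := B * (δ * σ ^ 35)) (ρ := 192 * A * B * (1 + D) * σ ^ 32)
      (S₀ := σ / 4) (S₁ := 1) (C₀ := δ * σ / 2) (C₁ := 2 * δ) (A := A)
      (by linarith) (by positivity) (by positivity)
      (fun x hx => by
        have h := hx.2.2
        simp only [Prod.fst_add, Prod.snd_add, neg_add_cancel_right, add_zero] at h
        rw [add_comm] at h
        convert h using 5
        ext <;> simp)
      (fun x hx => abs_cos_bounds hδ hσ hx.1) (fun x hx => abs_sin_bounds hδ hσ hx.1) (hβA p)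
      (by
        have e1 : 3 * (B * (δ * σ ^ 35) * 1 * (2 * δ)) * A = δ * σ ^ 35 * (6 * A * B * δ) := by ring
        have e2 : 192 * A * B * (1 + D) * σ ^ 32 * (σ / 4 * (δ * σ / 2) * (σ / 4))
            = δ * σ ^ 35 * (6 * A * B * (1 + D)) := by ring
        rw [e1, e2]
        have hA0 : 0 < A := by linarith
        gcongr
        linarith)
      hsmall hs
    rw [← abs_neg] at key
    convert key using 2
    have e : p + (Real.cos (δ * s.1), -Real.sin (δ * s.1))
        - (Real.cos (δ * s.2.1), -Real.sin (δ * s.2.1))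
        + (Real.cos (δ * s.2.2), -Real.sin (δ * s.2.2))
        = p + (δ ^ 2 * altSum (fun s => Real.cos (δ * s) / δ ^ 2) s,
          -(δ * altSum (fun s => Real.sin (δ * s) / δ) s)) := by
      ext <;> simp [altSum] <;> field_simp <;> ring
    simp only [e]
    simp only [altSum]
    ring

end Edges

theorem exists_quadrant {δ D σ s : ℝ} (hδ : 0 < δ) (hδD : δ ≤ D)
    (hs : s ∈ Icc (1 : ℝ) 2) :
    (∃ k ∈ Finset.range (⌊2 * D⌋₊ + 1), s ∈ quadrantPart δ σ k) ∨
      ∃ k ∈ Finset.range (⌊2 * D⌋₊ + 2), |s - k * (Real.pi / 2) / δ| ≤ σ := by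
  have hpi := Real.pi_gt_three
  have hpi2 : 0 < Real.pi / 2 := by positivity
  have ht : 0 ≤ δ * s := mul_nonneg hδ.le (by linarith [hs.1])
  set k := ⌊δ * s / (Real.pi / 2)⌋₊ with hk
  have hk1 : k * (Real.pi / 2) ≤ δ * s := by
    rw [← le_div_iff₀ hpi2]; exact Nat.floor_le (by positivity)
  have hk2 : δ * s < (k + 1) * (Real.pi / 2) := by
    rw [← div_lt_iff₀ hpi2]; exact Nat.lt_floor_add_one _
  have hkD : k ≤ ⌊2 * D⌋₊ := by
    refine Nat.floor_le_floor ?_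
    rw [div_le_iff₀ hpi2]
    nlinarith [hs.1, hs.2]
  have e : ∀ x : ℝ, |s - x / δ| ≤ σ ↔ |δ * s - x| ≤ δ * σ := by
    intro x
    have : δ * s - x = δ * (s - x / δ) := by field_simp
    rw [this, abs_mul, abs_of_pos hδ, mul_le_mul_iff_right₀ hδ]
  by_cases h1 : k * (Real.pi / 2) + δ * σ ≤ δ * s
  · by_cases h2 : δ * s ≤ (k + 1) * (Real.pi / 2) - δ * σ
    · exact Or.inl ⟨k, by simp; omega, (mem_quadrantPart hδ).2 ⟨hs, h1, h2⟩⟩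
    · push Not at h2
      refine Or.inr ⟨k + 1, by simp; omega, ?_⟩
      push_cast
      rw [e, abs_le]
      constructor <;> linarith
  · push Not at h1
    refine Or.inr ⟨k, by simp; omega, ?_⟩
    rw [e, abs_le]
    constructor <;> linarith

/-- The estimate for Borel measurable coefficients, given the bounds in the single quadrants. -/
theorem volume_sublevelSet_le_of_quadrants {δ D σ r c : ℝ} (hδ : 0 < δ) (hδD : δ ≤ D)
    (hσ : 0 < σ) (hc : 0 ≤ c) {Q V : Set (ℝ × ℝ)} (hVfin : volume V ≠ ⊤)
    (hQV : Q ⊆ V) {K : Set ((ℝ × ℝ) × ℝ)} (hK : MeasurableSet K)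
    (hKQ : K ⊆ Q ×ˢ Icc δ (2 * δ)) {α β : ℝ × ℝ → ℝ} (hα : Measurable α) (hβ : Measurable β)
    (hquad : ∀ k : ℕ, volume {x : (ℝ × ℝ) × ℝ | x.2 ∈ quadrantPart δ σ k ∧
      (x.1, δ * x.2) ∈ sublevelSet K α β r} ≤ ENNReal.ofReal (c * σ) * volume V) :
    volume (sublevelSet K α β r) ≤ ENNReal.ofReal
      (((⌊2 * D⌋₊ + 1) * c + (⌊2 * D⌋₊ + 2) * 2) * (volume V).toReal * (δ * σ)) := by
  have hm := measurableSet_sublevelSet hK hα hβ r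
  rw [volume_scale_snd hm hδ]
  have hbad : ∀ k : ℕ, volume (V ×ˢ {s : ℝ | |s - k * (Real.pi / 2) / δ| ≤ σ})
      = ENNReal.ofReal (2 * σ) * volume V := by
    intro k
    have : {s : ℝ | |s - k * (Real.pi / 2) / δ| ≤ σ}
        = Metric.closedBall (k * (Real.pi / 2) / δ) σ := by
      ext x; simp [Real.dist_eq]
    rw [Measure.volume_eq_prod, Measure.prod_prod, this, Real.volume_closedBall, mul_comm]
  have hcover : {x : (ℝ × ℝ) × ℝ | (x.1, δ * x.2) ∈ sublevelSet K α β r} ⊆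
      (⋃ k ∈ Finset.range (⌊2 * D⌋₊ + 1), {x : (ℝ × ℝ) × ℝ | x.2 ∈ quadrantPart δ σ k ∧
        (x.1, δ * x.2) ∈ sublevelSet K α β r}) ∪
      ⋃ k ∈ Finset.range (⌊2 * D⌋₊ + 2), V ×ˢ {s : ℝ | |s - k * (Real.pi / 2) / δ| ≤ σ} := by
    intro x hx
    obtain ⟨hxQ, h1, h2⟩ := hKQ hx.1
    have hs : x.2 ∈ Icc (1 : ℝ) 2 := by
      simp only at h1 h2
      constructor
      · exact le_of_mul_le_mul_left (by linarith) hδ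
      · exact le_of_mul_le_mul_left (by linarith) hδ
    rcases exists_quadrant (σ := σ) hδ hδD hs with ⟨k, hk, hkx⟩ | ⟨k, hk, hkx⟩
    · exact Or.inl (mem_biUnion (Finset.mem_coe.2 hk) ⟨hkx, hx⟩)
    · exact Or.inr (mem_biUnion (Finset.mem_coe.2 hk) ⟨hQV hxQ, hkx⟩)
  have hsum : volume {x : (ℝ × ℝ) × ℝ | (x.1, δ * x.2) ∈ sublevelSet K α β r} ≤
      ((⌊2 * D⌋₊ + 1 : ℕ) : ENNReal) * (ENNReal.ofReal (c * σ) * volume V) +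
      ((⌊2 * D⌋₊ + 2 : ℕ) : ENNReal) * (ENNReal.ofReal (2 * σ) * volume V) := by
    refine (measure_mono hcover).trans ((measure_union_le _ _).trans (add_le_add ?_ ?_))
    · refine (measure_biUnion_finset_le _ _).trans
        ((Finset.sum_le_sum fun k _ => hquad k).trans (le_of_eq ?_))
      rw [Finset.sum_const, Finset.card_range, nsmul_eq_mul]
    · refine (measure_biUnion_finset_le _ _).trans
        ((Finset.sum_le_sum fun k _ => (hbad k).le).trans (le_of_eq ?_))
      rw [Finset.sum_const, Finset.card_range, nsmul_eq_mul]
  refine (mul_le_mul_right hsum _).trans (le_of_eq ?_)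
  have hcσ : 0 ≤ c * σ := by positivity
  rw [← ENNReal.ofReal_toReal hVfin, ENNReal.toReal_ofReal ENNReal.toReal_nonneg,
    ← ENNReal.ofReal_natCast, ← ENNReal.ofReal_natCast, ← ENNReal.ofReal_mul hcσ,
    ← ENNReal.ofReal_mul (by positivity), ← ENNReal.ofReal_mul (by positivity),
    ← ENNReal.ofReal_mul (by positivity), ← ENNReal.ofReal_add (by positivity) (by positivity),
    ← ENNReal.ofReal_mul hδ.le]
  congr 1
  push_cast
  ring

theorem volume_sublevelSet_le_of_ae_eq {α β α' β' : ℝ × ℝ → ℝ} (hα : α =ᵐ[volume] α')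
    (hβ : β =ᵐ[volume] β') (K : Set ((ℝ × ℝ) × ℝ)) (r : ℝ) :
    volume (sublevelSet K α β r) ≤ volume (sublevelSet K α' β' r) := by
  have h1 := volume_add_mem_null (N := {z | ¬ α z = α' z}) hα
    (w := fun t => (Real.cos t, 0)) (by fun_prop)
  have h2 := volume_add_mem_null (N := {z | ¬ β z = β' z}) hβ
    (w := fun t => (0, Real.sin t)) (by fun_prop)
  refine (measure_mono (t := sublevelSet K α' β' r ∪
    ({x : (ℝ × ℝ) × ℝ | x.1 + (Real.cos x.2, 0) ∈ {z | ¬ α z = α' z}} ∪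
      {x : (ℝ × ℝ) × ℝ | x.1 + (0, Real.sin x.2) ∈ {z | ¬ β z = β' z}})) ?_).trans
    ((measure_union_le _ _).trans ?_)
  · intro x hx
    by_cases e1 : α (x.1 + (Real.cos x.2, 0)) = α' (x.1 + (Real.cos x.2, 0))
    · by_cases e2 : β (x.1 + (0, Real.sin x.2)) = β' (x.1 + (0, Real.sin x.2))
      · refine Or.inl ⟨hx.1, ?_⟩
        have f1 : x.1 + (Real.cos x.2, 0) = (x.1.1 + Real.cos x.2, x.1.2) := by ext <;> simp
        have f2 : x.1 + (0, Real.sin x.2) = (x.1.1, x.1.2 + Real.sin x.2) := by ext <;> simp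
        rw [f1] at e1
        rw [f2] at e2
        rw [← e1, ← e2]
        exact hx.2
      · exact Or.inr (Or.inr e2)
    · exact Or.inr (Or.inl e1)
  · rw [measure_union_null h1 h2, add_zero]

theorem exists_measurable_ae_eq_lower_bound {A : ℝ} (hA : 1 ≤ A) {α : ℝ × ℝ → ℝ}
    (hα : AEMeasurable α volume) (h : ∀ z, A⁻¹ ≤ |α z|) :
    ∃ α' : ℝ × ℝ → ℝ, Measurable α' ∧ α =ᵐ[volume] α' ∧ ∀ z, A⁻¹ ≤ |α' z| := by
  classical
  obtain ⟨α₁, hm, he⟩ := hα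
  refine ⟨fun z => if A⁻¹ ≤ |α₁ z| then α₁ z else 1, ?_, ?_, ?_⟩
  · refine Measurable.ite (measurableSet_le measurable_const ?_) hm measurable_const
    fun_prop
  · filter_upwards [he] with z hz
    have := h z
    rw [hz] at this
    rw [if_pos this, hz]
  · intro z
    beta_reduce
    split_ifs with hz
    · exact hz
    · rw [abs_one]; exact inv_le_one_of_one_le₀ hA

/-- `A` is the constant implicit in `∼ 1` and `≲ 1`, `B` the one implicit in `≲ δ ε`; `C` is the
constant of the conclusion. `C` is uniform over all scales `δ ∈ (0, D]`, all compact
`K ⊆ Q × [δ, 2δ]`, all Lebesgue measurable `α, β`, and all `ε ∈ (0, 1]`. -/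
theorem theorem3p4 (A B D : ℝ) (hA : 1 ≤ A) (hB : 0 < B) (hD : 0 < D)
    (Q : Set (ℝ × ℝ)) (hQ : IsCompact Q) :
    ∃ C : ℝ, 0 < C ∧
      ∀ δ : ℝ, 0 < δ → δ ≤ D →
      ∀ K : Set ((ℝ × ℝ) × ℝ), IsCompact K → K ⊆ Q ×ˢ Set.Icc δ (2 * δ) →
      ∀ α β : ℝ × ℝ → ℝ,
        AEMeasurable α MeasureTheory.volume → AEMeasurable β MeasureTheory.volume →
        ((∀ z, A⁻¹ ≤ |α z| ∧ |α z| ≤ A) ∧ (∀ z, |β z| ≤ A) ∨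
          (∀ z, |α z| ≤ A) ∧ (∀ z, A⁻¹ ≤ |β z| ∧ |β z| ≤ A)) →
      ∀ ε : ℝ, 0 < ε → ε ≤ 1 →
        MeasureTheory.volume (sublevelSet K α β (B * (δ * ε)))
          ≤ ENNReal.ofReal (C * (δ * ε ^ (1 / 35 : ℝ))) := by
  have hA0 : 0 < A := by linarith
  obtain ⟨ρ, hρ, hQρ⟩ := hQ.isBounded.exists_pos_norm_le
  set V : Set (ℝ × ℝ) := Metric.closedBall 0 (ρ + 1) with hVdef
  have hVm : MeasurableSet V := Metric.isClosed_closedBall.measurableSet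
  have hVfin : volume V ≠ ⊤ := (isCompact_closedBall _ _).measure_lt_top.ne
  have hadd : ∀ z ∈ Q, ∀ w : ℝ × ℝ, ‖w‖ ≤ 1 → z + w ∈ V := fun z hz w hw => by
    rw [hVdef, mem_closedBall_zero_iff]
    exact (norm_add_le _ _).trans (add_le_add (hQρ z hz) hw)
  have hQV : Q ⊆ V := fun z hz => by simpa using hadd z hz 0 (by simp)
  set c := 2 + quadrantConst D (192 * A * B * (1 + D)) with hc
  have hc0 : 0 < c := by
    have : 0 ≤ quadrantConst D (192 * A * B * (1 + D)) := quadrantConst_nonneg (by positivity)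
    linarith
  set C := ((⌊2 * D⌋₊ + 1) * c + (⌊2 * D⌋₊ + 2) * 2) * (volume V).toReal with hC
  have hC0 : 0 ≤ C := by positivity
  refine ⟨C + 1, by linarith, ?_⟩
  intro δ hδ hδD K hK hKQ α β hα hβ hαβ ε hε hε1
  set σ := ε ^ (1 / 35 : ℝ) with hσdef
  have hσ : 0 < σ := Real.rpow_pos_of_pos hε _
  have hσ1 : σ ≤ 1 := Real.rpow_le_one hε.le hε1 (by norm_num)
  have hεσ : ε = σ ^ 35 := by
    rw [hσdef, ← Real.rpow_natCast, ← Real.rpow_mul hε.le]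
    norm_num
  have hKm : MeasurableSet K := hK.isClosed.measurableSet
  have hKV : ∀ x ∈ K, x.1 + (Real.cos x.2, 0) ∈ V ∧ x.1 + (0, Real.sin x.2) ∈ V := by
    intro x hx
    refine ⟨hadd _ (hKQ hx).1 _ ?_, hadd _ (hKQ hx).1 _ ?_⟩
    · simpa [Prod.norm_def] using Real.abs_cos_le_one x.2
    · simpa [Prod.norm_def] using Real.abs_sin_le_one x.2
  have hfinal : volume (sublevelSet K α β (B * (δ * ε))) ≤ ENNReal.ofReal (C * (δ * σ)) := by
    rw [hεσ]
    rcases hαβ with ⟨h, -⟩ | ⟨-, h⟩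
    · obtain ⟨α', hαm, hαe, hαA⟩ := exists_measurable_ae_eq_lower_bound hA hα fun z => (h z).1
      obtain ⟨β', hβm, hβe⟩ := hβ
      exact (volume_sublevelSet_le_of_ae_eq hαe hβe K _).trans
        (volume_sublevelSet_le_of_quadrants hδ hδD hσ hc0.le hVfin hQV hKm hKQ hαm hβm
          fun k => volume_quadrant_le_of_left hA hB hδ hδD hσ hσ1 hKm hαm hβm hαA hVm hKV)
    · obtain ⟨β', hβm, hβe, hβA⟩ := exists_measurable_ae_eq_lower_bound hA hβ fun z => (h z).1
      obtain ⟨α', hαm, hαe⟩ := hα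
      exact (volume_sublevelSet_le_of_ae_eq hαe hβe K _).trans
        (volume_sublevelSet_le_of_quadrants hδ hδD hσ hc0.le hVfin hQV hKm hKQ hαm hβm
          fun k => volume_quadrant_le_of_right hA hB hδ hδD hσ hσ1 hKm hαm hβm hβA hVm hKV)
  refine hfinal.trans (ENNReal.ofReal_le_ofReal ?_)
  have : 0 ≤ δ * σ := by positivity
  linarith
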